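/- **Setting.** Let $\mathcal H_0$ be a separable complex Hilbert space with inner product $\langle\cdot,\cdot\rangle$ and norm $\|\cdot\|$, and let $A$ be a selfadjoint operator in $\mathcal H_0$ with domain $\mathcal D(A)$ which is positive definite: $\langle Au,u\rangle\ge\alpha\|u\|^2$ on $\mathcal D(A)$ for some $\alpha>0$. Put $T=A^{-1}$. For real $s$ let $A^s$ be the power defined by the spectral theorem, and write $\langle x,y\rangle_s=\langle A^sx,A^sy\rangle$, $\|x\|_s=\|A^sx\|$ for $x,y\in\mathcal D(A^s)$. Let $\lambda_1\le\dots\le\lambda_\ell$ be the first $\ell$ eigenvalues of $A$, counted with multiplicity and lying strictly below the essential spectrum of $A$, with corresponding orthonormal eigenvectors $u_1,\dots,u_\ell$. Let $\mathcal G_0$ be a Hilbert space consisting of the same elements as $\mathcal H_0$ with an equivalent norm $|\cdot|_0$, and let $M$ be a positive definite selfadjoint operator in $\mathcal G_0$ with $M^{-1}$ compact, with eigenvalues $0<\mu_1\le\mu_2\le\dots\to\infty$ counted with multiplicity and corresponding eigenvectors $q_1,q_2,\dots$, orthonormal in $\mathcal G_0$. For $0\le\tau\le1$ and $n\ge1$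 let $\Lambda_1^{(n,\tau)}\le\dots\le\Lambda_n^{(n,\tau)}$ be the eigenvalues of the generalized matrix eigenvalue problem $$\big[\langle q_i,q_k\rangle_\tau\big]_{i,k=1}^n\,\mathbf x=\Lambda\,\big[\langle Tq_i,q_k\rangle_\tau\big]_{i,k=1}^n\,\mathbf x ,$$ and let $u_1^{(n,\tau)},\dots,u_n^{(n,\tau)}\in\operatorname{span}\{q_1,\dots,q_n\}$ be corresponding eigenvectors, orthonormalized by $\langle u_i^{(n,\tau)},u_j^{(n,\tau)}\rangle_{\tau-1/2}=\delta_{ij}$. **Proposition.** Assume that $\mathcal D(M)$ is continuously contained in $\mathcal D(A)$, i.e. $\mathcal D(M)\subset\mathcal D(A)$ and $\|Av\|\le C\,|Mv|_0$ for all $v\in\mathcal D(M)$, with some constant $C$. Let $0\le\tau\le1$ and $\sigma\ge\tau$, and suppose that $u_1,\dots,u_\ell$ all belong to $\mathcal D(M^\sigma)$. Then for every $1\le j\le\ell$, as $n\to\infty$, $$\Lambda_j^{(n,\tau)}=\lambda_j+o\big(\mu_{n+1}^{2\tau-2\sigma}\big),$$ and there are eigenvectors $u_{j,n}$ of $A$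 in the $\lambda_j$-eigenspace, normalized by $\|u_{j,n}\|_{\tau-1/2}=1$, such that $$\|u_{j,n}-u_j^{(n,\tau)}\|_\tau=o\big(\mu_{n+1}^{\tau-\sigma}\big).$$ -/

import Mathlib

open Filter Asymptotics

/-- A positive definite selfadjoint (in general unbounded) operator in a complex Hilbert space:
a densely defined operator which equals its own Hilbert space adjoint, domain included, with a
strictly positive lower bound. -/
structure PosDefOp (H : Type*) [NormedAddCommGroup H] [InnerProductSpace ℂ H]
    [CompleteSpace H] where
  /-- The operator, as a linear map on its domain `op.domain`. -/
  op : H →ₗ.[ℂ] H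
  isSelfAdjoint : IsSelfAdjoint op
  coercive : ∃ α : ℝ, 0 < α ∧ ∀ x : op.domain, α * ‖(x : H)‖ ^ 2 ≤ (inner ℂ (op x) (x : H)).re

namespace PosDefOp

variable {H : Type*} [NormedAddCommGroup H] [InnerProductSpace ℂ H] [CompleteSpace H]

theorem exists_lower_bound (A : PosDefOp H) :
    ∃ α : ℝ, 0 < α ∧ ∀ x : A.op.domain, α * ‖(x : H)‖ ≤ ‖A.op x‖ := by
  obtain ⟨α, hα, h⟩ := A.coercive
  refine ⟨α, hα, fun x => ?_⟩
  rcases (norm_nonneg (x : H)).eq_or_lt with h0 | h0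
  · rw [← h0]; simp
  · have h1 := h x
    have h2 : (inner ℂ (A.op x) (x : H)).re ≤ ‖A.op x‖ * ‖(x : H)‖ :=
      (Complex.re_le_norm _).trans (norm_inner_le_norm _ _)
    have h3 : (α * ‖(x : H)‖) * ‖(x : H)‖ ≤ ‖A.op x‖ * ‖(x : H)‖ := by nlinarith
    exact le_of_mul_le_mul_right h3 h0

theorem surjective (A : PosDefOp H) : ∀ y : H, ∃ x : A.op.domain, A.op x = y := by
  obtain ⟨α, hα, hb⟩ := A.exists_lower_bound
  set K : Submodule ℂ H := LinearMap.range A.op.toFun with hK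
  have hclosed : IsClosed (K : Set H) := by
    rw [← isSeqClosed_iff_isClosed]
    intro y y₀ hy hlim
    choose x hx using hy
    have hxc : CauchySeq (fun n => (x n : H)) := by
      have hyc := hlim.cauchySeq
      rw [Metric.cauchySeq_iff] at hyc ⊢
      intro ε hε
      obtain ⟨N, hN⟩ := hyc (α * ε) (by positivity)
      refine ⟨N, fun m hm n hn => ?_⟩
      have h1 := hb (x m - x n)
      have h2 : A.op (x m - x n) = y m - y n := by
        rw [LinearPMap.map_sub, ← hx m, ← hx n]; rfl
      have h3 := hN m hm n hn
      rw [h2, Submodule.coe_sub] at h1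
      rw [dist_eq_norm] at h3 ⊢
      exact lt_of_mul_lt_mul_left (h1.trans_lt h3) hα.le
    obtain ⟨x₀, hx₀⟩ := cauchySeq_tendsto_of_complete hxc
    have hg : (x₀, y₀) ∈ A.op.graph := by
      have hcl : IsClosed (A.op.graph : Set (H × H)) := A.isSelfAdjoint.isClosed
      refine hcl.mem_of_tendsto (hx₀.prodMk_nhds hlim) (Eventually.of_forall fun n => ?_)
      rw [SetLike.mem_coe, LinearPMap.mem_graph_iff]
      exact ⟨x n, rfl, hx n⟩
    rw [LinearPMap.mem_graph_iff] at hg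
    obtain ⟨z, -, hz⟩ := hg
    exact ⟨z, hz⟩
  have : CompleteSpace K := hclosed.completeSpace_coe
  have hperp : Kᗮ = ⊥ := by
    rw [Submodule.eq_bot_iff]
    intro y hy
    have hy' : ∀ x : A.op.domain, inner ℂ (0 : H) (x : H) = inner ℂ y (A.op x) := by
      intro x
      rw [inner_zero_left]
      exact ((Submodule.mem_orthogonal' K y).1 hy _ ⟨x, rfl⟩).symm
    have hmem : y ∈ A.op.adjoint.domain :=
      LinearPMap.mem_adjoint_domain_of_exists y ⟨0, hy'⟩
    have h0 : A.op.adjoint ⟨y, hmem⟩ = 0 :=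
      LinearPMap.adjoint_apply_eq A.isSelfAdjoint.dense_domain ⟨y, hmem⟩ hy'
    have hg : (y, (0 : H)) ∈ A.op.adjoint.graph := by
      rw [LinearPMap.mem_graph_iff]
      exact ⟨⟨y, hmem⟩, rfl, h0⟩
    rw [LinearPMap.isSelfAdjoint_def.1 A.isSelfAdjoint, LinearPMap.mem_graph_iff] at hg
    obtain ⟨z, hz, hz0⟩ := hg
    have h1 := hb z
    rw [hz0, hz, norm_zero] at h1
    have h2 : ‖y‖ ≤ 0 := by
      by_contra hc
      push Not at hc
      nlinarith [mul_pos hα hc]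
    exact norm_le_zero_iff.1 h2
  have htop : K = ⊤ := by
    rwa [Submodule.orthogonal_eq_bot_iff] at hperp
  intro y
  have : y ∈ K := htop ▸ Submodule.mem_top
  exact this

theorem exists_inv (A : PosDefOp H) :
    ∃ T : H →L[ℂ] H, (∀ y : H, ∃ h : T y ∈ A.op.domain, A.op ⟨T y, h⟩ = y) ∧
      ∀ x : A.op.domain, T (A.op x) = x := by
  obtain ⟨α, hα, hb⟩ := A.exists_lower_bound
  have hinj : ∀ x x' : A.op.domain, A.op x = A.op x' → x = x' := by
    intro x x' h
    have h1 := hb (x - x')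
    rw [LinearPMap.map_sub, h, sub_self, norm_zero] at h1
    have h2 : ‖((x - x' : A.op.domain) : H)‖ ≤ 0 := by
      by_contra hc
      push Not at hc
      nlinarith [mul_pos hα hc]
    exact sub_eq_zero.1 (Subtype.ext (norm_le_zero_iff.1 h2))
  choose g hg using A.surjective
  let T₀ : H →ₗ[ℂ] H :=
    { toFun := fun y => (g y : H)
      map_add' := fun y z => by
        have : g (y + z) = g y + g z := hinj _ _ (by rw [LinearPMap.map_add, hg, hg, hg])
        rw [this]; rfl
      map_smul' := fun c y => by
        have : g (c • y) = c • g y := hinj _ _ (by rw [LinearPMap.map_smul, hg, hg])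
        rw [this]; rfl }
  refine ⟨T₀.mkContinuous α⁻¹ fun y => ?_, fun y => ⟨(g y).2, hg y⟩, fun x => ?_⟩
  · have h1 := hb (g y)
    rw [hg] at h1
    rw [inv_mul_eq_div, le_div_iff₀ hα, mul_comm]
    exact h1
  · exact congrArg Subtype.val (hinj _ _ (hg (A.op x)))

/-- The inverse `T = A⁻¹`, an everywhere defined bounded operator. -/
noncomputable def inv (A : PosDefOp H) : H →L[ℂ] H := A.exists_inv.choose

theorem inv_spec (A : PosDefOp H) :
    (∀ y : H, ∃ h : A.inv y ∈ A.op.domain, A.op ⟨A.inv y, h⟩ = y) ∧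
      ∀ x : A.op.domain, A.inv (A.op x) = x :=
  A.exists_inv.choose_spec

/-- The real power `A ^ s`, as an operator with its domain.  With `T = A⁻¹`, whose powers `T ^ t`
(`t ≥ 0`) are given by the continuous functional calculus of the bounded positive injective
operator `T`: for `s ≥ 0`, `A ^ s` is the inverse of the injective operator `T ^ s`, so that its
domain is the range of `T ^ s`; for `s < 0`, `A ^ s` is the bounded operator `T ^ (-s)`,
restricted to `H` (its extension to a completion of `H` is not needed). -/
noncomputable def rpow (A : PosDefOp H) (s : ℝ) : H →ₗ.[ℂ] H :=
  if 0 ≤ s then ((A.inv ^ s : H →L[ℂ] H).toLinearMap.toPMap ⊤).inverse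
  else (A.inv ^ (-s) : H →L[ℂ] H).toLinearMap.toPMap ⊤

open Classical in
/-- The vector `A ^ s x` for `x` in the domain of `A ^ s` (and `0` for other `x`). -/
noncomputable def powApply (A : PosDefOp H) (s : ℝ) (x : H) : H :=
  if h : x ∈ (A.rpow s).domain then A.rpow s ⟨x, h⟩ else 0

/-- The inner product `⟨x, y⟩_s = ⟨A ^ s x, A ^ s y⟩` of the space `D(A ^ s)`. -/
noncomputable def fracInner (A : PosDefOp H) (s : ℝ) (x y : H) : ℂ :=
  inner ℂ (A.powApply s x) (A.powApply s y)

/-- The norm `‖x‖_s = ‖A ^ s x‖` of the space `D(A ^ s)`. -/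
noncomputable def fracNorm (A : PosDefOp H) (s : ℝ) (x : H) : ℝ := ‖A.powApply s x‖

/-- `x` belongs to the kernel of `A - z`. -/
def IsEigen (A : PosDefOp H) (z : ℂ) (x : H) : Prop :=
  ∃ h : x ∈ A.op.domain, A.op ⟨x, h⟩ = z • x

/-- The kernel of `A - z`. -/
def eigenspace (A : PosDefOp H) (z : ℂ) : Submodule ℂ H where
  carrier := {x | A.IsEigen z x}
  zero_mem' := ⟨A.op.domain.zero_mem, by rw [smul_zero]; exact LinearPMap.map_zero _⟩
  add_mem' := by
    rintro x y ⟨hx, ex⟩ ⟨hy, ey⟩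
    refine ⟨A.op.domain.add_mem hx hy, ?_⟩
    rw [smul_add, ← ex, ← ey]
    exact LinearPMap.map_add _ ⟨x, hx⟩ ⟨y, hy⟩
  smul_mem' := by
    rintro c x ⟨hx, ex⟩
    refine ⟨A.op.domain.smul_mem c hx, ?_⟩
    rw [smul_comm, ← ex]
    exact LinearPMap.map_smul _ c ⟨x, hx⟩

/-- The spectrum of `A`: the complex numbers `z` for which `A - z` has no everywhere defined
bounded inverse. -/
def spectrum (A : PosDefOp H) : Set ℂ :=
  {z | ¬ ∃ R : H →L[ℂ] H,
    (∀ y : H, ∃ h : R y ∈ A.op.domain, A.op ⟨R y, h⟩ - z • R y = y) ∧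
    ∀ x : A.op.domain, R (A.op x - z • (x : H)) = x}

/-- The essential spectrum of the selfadjoint operator `A`: the points of the spectrum which are
not isolated eigenvalues of finite multiplicity. -/
def essSpectrum (A : PosDefOp H) : Set ℂ :=
  {z ∈ A.spectrum | ¬ ((∃ ε > 0, ∀ z' ∈ A.spectrum, dist z' z < ε → z' = z) ∧
    A.eigenspace z ≠ ⊥ ∧ FiniteDimensional ℂ (A.eigenspace z))}

/-- `lam` lists in nondecreasing order the lowest eigenvalues of `A`, repeated according to
multiplicity, and `u` is a corresponding orthonormal family of eigenvectors: an eigenvector of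
`A` orthogonal to the whole family belongs to an eigenvalue not smaller than any in the list. -/
structure IsLowestEigenpairs (A : PosDefOp H) {ι : Type*} [LinearOrder ι]
    (lam : ι → ℝ) (u : ι → H) : Prop where
  mono : Monotone lam
  orthonormal : Orthonormal ℂ u
  eigen : ∀ j, A.IsEigen (lam j : ℂ) (u j)
  lowest : ∀ (nu : ℝ) (w : H), w ≠ 0 → A.IsEigen (nu : ℂ) w →
    (∀ j, inner ℂ (u j) w = 0) → ∀ j, lam j ≤ nu

/-- The Rayleigh-Ritz method in `D(A ^ τ)` with the trial vectors `w 0, …, w (n - 1)`: with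
`T = A⁻¹`, the numbers `Lam 0 ≤ … ≤ Lam (n - 1)` are the eigenvalues of the generalized matrix
eigenvalue problem `[⟨w i, w j⟩_τ] x = Λ [⟨T (w i), w j⟩_τ] x`, and the vectors `U j`, formed
from the trial vectors with eigenvectors `x` as coefficients, are orthonormal in
`D(A ^ (τ - 1/2))`. -/
def IsRitz (A : PosDefOp H) (τ : ℝ) {n : ℕ} (w : Fin n → H) (Lam : Fin n → ℝ)
    (U : Fin n → H) : Prop :=
  Monotone Lam ∧
  (∀ j, ∃ x : Fin n → ℂ,
    (Matrix.of fun i k => A.fracInner τ (w i) (w k)).mulVec x =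
      (Lam j : ℂ) • (Matrix.of fun i k => A.fracInner τ (A.inv (w i)) (w k)).mulVec x ∧
    U j = ∑ k, x k • w k) ∧
  ∀ i j, A.fracInner (τ - 1 / 2) (U i) (U j) = if i = j then 1 else 0

end PosDefOp

/-!
The isometry `A ^ τ` from `D(A ^ τ)` onto `H` turns the Rayleigh-Ritz method in `D(A ^ τ)` into the
Galerkin method for the bounded operator `T = A⁻¹` in `H`, with the transported trial spaces `V n`
(`IsRitz.exists_isGalerkinSystem`). The proof then has two independent halves.

*Approximation.* By the Heinz inequality, here for two spaces
(`ContinuousLinearMap.exists_norm_le_of_rpow_apply_eq`), the inclusion of `D(M)` in `D(A)` yields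
`‖A ^ τ e x‖ ≤ D ‖M ^ τ x‖`. The distance from an eigenvector of `A` to `V n` is therefore at most
a constant times the norm of the Fourier remainder of `M ^ τ u = M ^ (τ - σ) M ^ σ u` with respect
to the complete orthonormal system `q`, which is `o(μ n ^ (τ - σ))`
(`PosDefOp.exists_isLittleO_dist_trialSpace`).

*Error estimates.* Let `δ` bound the distances of `u 0, …, u (ℓ - 1)` to the trial space. Then Ritz
values are in error by `O(δ ^ 2)` and Ritz vectors by `O(δ)` (`exists_ritz_error_le`). For the
values, the minimum principle gives `lam j ≤ Lam j`, and the Rayleigh quotients on the projection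
of the span of `u 0, …, u j` give the converse bound. For the vectors, the part of a Ritz vector
`Y j` outside the eigenspace of `lam j` is bounded by its Rayleigh quotient and by its components
along the lower eigenvectors (`exists_dist_eigenspace_le`), and these components are `O(δ)` since
`(1 / lam i - 1 / Lam j) ⟨u i, Y j⟩ = ⟨u i - P u i, T (Y j)⟩`, with `P` the projection onto the
trial space. Regularity of the eigenvectors for `lam j` outside the list is not needed. The spectral
gap behind these estimates (`exists_gap`) is where the hypothesis on the essential spectrum enters.
-/

/-! ### Powers of bounded positive operators -/

namespace ContinuousLinearMap

variable {H : Type*} [NormedAddCommGroup H] [InnerProductSpace ℂ H] [CompleteSpace H]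
  {T : H →L[ℂ] H}

theorem rpow_add_of_nonneg (hT : 0 ≤ T) {s t : ℝ} (hs : 0 ≤ s) (ht : 0 ≤ t) :
    T ^ (s + t) = T ^ s * T ^ t := by
  rcases hs.eq_or_lt with rfl | hs
  · rw [zero_add, CFC.rpow_zero T hT, one_mul]
  rcases ht.eq_or_lt with rfl | ht
  · rw [add_zero, CFC.rpow_zero T hT, mul_one]
  lift s to NNReal using hs.le
  lift t to NNReal using ht.le
  have hs' : 0 < s := hs
  have ht' : 0 < t := ht
  rw [← NNReal.coe_add, ← CFC.nnrpow_eq_rpow hs', ← CFC.nnrpow_eq_rpow ht',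
    ← CFC.nnrpow_eq_rpow (add_pos hs' ht'), CFC.nnrpow_add hs' ht']

theorem rpow_add_apply (hT : 0 ≤ T) {s t : ℝ} (hs : 0 ≤ s) (ht : 0 ≤ t) (x : H) :
    (T ^ (s + t)) x = (T ^ s) ((T ^ t) x) := by
  rw [rpow_add_of_nonneg hT hs ht]; rfl

omit [CompleteSpace H] in
theorem inner_left_eq_right_of_nonneg (hT : 0 ≤ T) (x y : H) :
    inner ℂ (T x) y = inner ℂ x (T y) :=
  ((nonneg_iff_isPositive T).1 hT).isSymmetric x y

theorem inner_rpow (s : ℝ) (x y : H) :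
    inner ℂ ((T ^ s) x) y = inner ℂ x ((T ^ s) y) :=
  inner_left_eq_right_of_nonneg CFC.rpow_nonneg x y

theorem rpow_injective (hT : 0 ≤ T) (hi : Function.Injective T) {s : ℝ} (hs : 0 ≤ s) :
    Function.Injective (T ^ s : H →L[ℂ] H) := by
  rw [injective_iff_map_eq_zero] at hi ⊢
  intro x hx
  obtain ⟨n, hn⟩ := exists_nat_ge s
  have h1 : (T ^ n) x = 0 := by
    rw [← CFC.rpow_natCast T n hT, ← sub_add_cancel (n : ℝ) s,
      rpow_add_apply hT (sub_nonneg.2 hn) hs, hx, map_zero]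
  clear hn
  induction n with
  | zero => simpa using h1
  | succ n ih => exact ih (hi _ (by rw [pow_succ'] at h1; exact h1))

theorem denseRange_rpow (hT : 0 ≤ T) (hi : Function.Injective T) {s : ℝ} (hs : 0 ≤ s) :
    DenseRange (T ^ s : H →L[ℂ] H) := by
  have h : (LinearMap.range (T ^ s : H →L[ℂ] H).toLinearMap)ᗮ = ⊥ := by
    rw [Submodule.eq_bot_iff]
    intro x hx
    refine rpow_injective hT hi hs ?_
    rw [map_zero, ← inner_self_eq_zero (𝕜 := ℂ), inner_rpow]
    exact (Submodule.mem_orthogonal' _ x).1 hx _ ⟨(T ^ s) x, rfl⟩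
  have := Submodule.topologicalClosure_eq_top_iff.2 h
  exact Submodule.dense_iff_topologicalClosure_eq_top.2 this

/-- The continuous functional calculus acts on an eigenvector by evaluation at the eigenvalue. -/
theorem cfc_apply_of_eigenvector (hT : IsSelfAdjoint T) {f : ℝ → ℝ} {k : ℝ} {x : H}
    (hf : ContinuousOn f (_root_.spectrum ℝ T)) (hx : x ≠ 0) (h : T x = (k : ℂ) • x) :
    cfc f T x = (f k : ℂ) • x := by
  have hk : k ∈ _root_.spectrum ℝ T := by
    intro hu
    have h1 : IsUnit (algebraMap ℝ (H →L[ℂ] H) k - T) := hu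
    have h2 : (algebraMap ℝ (H →L[ℂ] H) k - T) x = 0 := by
      rw [sub_apply, h, Algebra.algebraMap_eq_smul_one]
      simp
    obtain ⟨v, hv⟩ := h1
    have h3 : ((↑v⁻¹ : H →L[ℂ] H) * ↑v) x = x := by simp
    rw [hv] at h3
    change (↑v⁻¹ : H →L[ℂ] H) ((algebraMap ℝ (H →L[ℂ] H) k - T) x) = x at h3
    rw [h2, map_zero] at h3
    exact hx h3.symm
  rw [cfc_apply f T]
  have key : ∀ g : C(_root_.spectrum ℝ T, ℝ),
      cfcHom (show IsSelfAdjoint T from hT) g x = (g ⟨k, hk⟩ : ℂ) • x := by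
    intro g
    have hX : cfcHom (show IsSelfAdjoint T from hT)
        (.restrict (_root_.spectrum ℝ T) (.id ℝ)) = T := cfcHom_id _
    induction g using ContinuousMap.induction_on_of_compact with
    | const r =>
      have : (ContinuousMap.const (_root_.spectrum ℝ T) r) = algebraMap ℝ _ r := rfl
      rw [this, AlgHomClass.commutes, Algebra.algebraMap_eq_smul_one]
      simp [Algebra.algebraMap_eq_smul_one]
    | id => rw [hX, h]; rfl
    | star_id =>
      rw [map_star, hX, hT.star_eq, h]; rfl
    | add f g hf hg => rw [map_add, add_apply, hf, hg, ← add_smul]; simp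
    | mul f g hf hg =>
      rw [map_mul]
      change cfcHom (show IsSelfAdjoint T from hT) f (cfcHom (show IsSelfAdjoint T from hT) g x) = _
      rw [hg, map_smul, hf, smul_smul]; simp [mul_comm]
    | frequently f hf =>
      refine hf.mem_of_closed (isClosed_eq ?_ ?_)
      · have := cfcHom_continuous (R := ℝ) (a := T) hT
        fun_prop
      · fun_prop
  exact key _

theorem rpow_apply_of_eigenvector (hT : 0 ≤ T) {s k : ℝ} (hs : 0 ≤ s) {x : H}
    (h : T x = (k : ℂ) • x) : (T ^ s) x = ((k ^ s : ℝ) : ℂ) • x := by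
  rcases eq_or_ne x 0 with rfl | hx
  · simp
  rw [CFC.rpow_eq_cfc_real hT]
  exact cfc_apply_of_eigenvector hT.isSelfAdjoint
    (Real.continuous_rpow_const hs).continuousOn hx h

end ContinuousLinearMap

/-! ### The inverse and the powers of a positive definite operator -/

namespace PosDefOp

variable {H : Type*} [NormedAddCommGroup H] [InnerProductSpace ℂ H] [CompleteSpace H]
  (A : PosDefOp H)

theorem inv_mem (y : H) : A.inv y ∈ A.op.domain := (A.inv_spec.1 y).1

theorem op_inv (y : H) : A.op ⟨A.inv y, A.inv_mem y⟩ = y := (A.inv_spec.1 y).2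

theorem inv_op (x : A.op.domain) : A.inv (A.op x) = x := A.inv_spec.2 x

theorem inner_op (x y : A.op.domain) : inner ℂ (A.op x) (y : H) = inner ℂ (x : H) (A.op y) := by
  have h := LinearPMap.adjoint_isFormalAdjoint A.isSelfAdjoint.dense_domain
  rw [LinearPMap.isSelfAdjoint_def.1 A.isSelfAdjoint] at h
  exact h x y

theorem inv_nonneg : 0 ≤ A.inv := by
  rw [ContinuousLinearMap.nonneg_iff_isPositive]
  refine ⟨fun x y => ?_, fun x => ?_⟩
  · have := A.inner_op ⟨A.inv x, A.inv_mem x⟩ ⟨A.inv y, A.inv_mem y⟩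
    rw [op_inv, op_inv] at this
    exact this.symm
  · obtain ⟨α, hα, h⟩ := A.coercive
    have h1 := h ⟨A.inv x, A.inv_mem x⟩
    rw [op_inv] at h1
    rw [ContinuousLinearMap.reApplyInnerSelf_apply, inner_re_symm]
    exact le_trans (by positivity) h1

theorem inv_injective : Function.Injective A.inv := by
  rw [injective_iff_map_eq_zero]
  intro x hx
  rw [← A.op_inv x]
  have : (⟨A.inv x, A.inv_mem x⟩ : A.op.domain) = 0 := Subtype.ext hx
  rw [this, LinearPMap.map_zero]

theorem mem_domain_iff {x : H} : x ∈ A.op.domain ↔ ∃ y, A.inv y = x :=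
  ⟨fun h => ⟨_, A.inv_op ⟨x, h⟩⟩, fun ⟨y, h⟩ => h ▸ A.inv_mem y⟩

theorem isEigen_iff {z : ℂ} (hz : z ≠ 0) {x : H} : A.IsEigen z x ↔ A.inv x = z⁻¹ • x := by
  constructor
  · rintro ⟨h, e⟩
    have := A.inv_op ⟨x, h⟩
    rw [e, map_smul] at this
    rw [eq_inv_smul_iff₀ hz, this]
  · intro h
    have h1 : A.inv (z • x) = x := by rw [map_smul, h, smul_inv_smul₀ hz]
    refine ⟨h1 ▸ A.inv_mem _, ?_⟩
    have h2 := A.op_inv (z • x)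
    have : (⟨A.inv (z • x), A.inv_mem _⟩ : A.op.domain) = ⟨x, h1 ▸ A.inv_mem _⟩ :=
      Subtype.ext h1
    rwa [this] at h2

theorem pos_of_isEigen {a : ℝ} {x : H} (hx : x ≠ 0) (h : A.IsEigen (a : ℂ) x) : 0 < a := by
  obtain ⟨hd, e⟩ := h
  obtain ⟨α, hα, hc⟩ := A.coercive
  have h1 := hc ⟨x, hd⟩
  rw [e, inner_smul_left] at h1
  simp only [Complex.conj_ofReal, Complex.re_ofReal_mul] at h1
  have h2 : (inner ℂ x x).re = ‖x‖ ^ 2 := inner_self_eq_norm_sq (𝕜 := ℂ) x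
  rw [h2] at h1
  have h3 : 0 < ‖x‖ ^ 2 := by positivity
  exact hα.trans_le (le_of_mul_le_mul_right h1 h3)

theorem inv_apply_of_isEigen {a : ℝ} {x : H} (hx : x ≠ 0) (h : A.IsEigen (a : ℂ) x) :
    A.inv x = ((a⁻¹ : ℝ) : ℂ) • x := by
  have := (A.isEigen_iff (by exact_mod_cast (A.pos_of_isEigen hx h).ne')).1 h
  rw [this]; simp

theorem mem_rpow_domain {s : ℝ} (hs : 0 ≤ s) {x : H} :
    x ∈ (A.rpow s).domain ↔ ∃ w, (A.inv ^ s) w = x := by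
  rw [rpow, if_pos hs, LinearPMap.inverse_domain]
  constructor
  · rintro ⟨w, hw⟩; exact ⟨w, hw⟩
  · rintro ⟨w, hw⟩; exact ⟨⟨w, trivial⟩, hw⟩

theorem rpow_apply_mem {s : ℝ} (hs : 0 ≤ s) (w : H) : (A.inv ^ s) w ∈ (A.rpow s).domain :=
  (A.mem_rpow_domain hs).2 ⟨w, rfl⟩

theorem powApply_rpow {s : ℝ} (hs : 0 ≤ s) (w : H) : A.powApply s ((A.inv ^ s) w) = w := by
  have h := A.rpow_apply_mem hs w
  rw [powApply, dif_pos h]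
  revert h
  rw [rpow, if_pos hs]
  intro h
  refine LinearPMap.inverse_apply_eq
    (f := (A.inv ^ s : H →L[ℂ] H).toLinearMap.toPMap ⊤) (x := ⟨w, Submodule.mem_top⟩) ?_ rfl
  rw [LinearMap.ker_eq_bot']
  rintro ⟨m, hm⟩ h0
  exact Subtype.ext (ContinuousLinearMap.rpow_injective A.inv_nonneg A.inv_injective hs
    (h0.trans (map_zero _).symm))

theorem mem_rpow_domain_of_neg {s : ℝ} (hs : s < 0) (x : H) : x ∈ (A.rpow s).domain := by
  rw [rpow, if_neg hs.not_ge]; trivial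

theorem powApply_of_neg {s : ℝ} (hs : s < 0) (x : H) :
    A.powApply s x = (A.inv ^ (-s)) x := by
  have h := A.mem_rpow_domain_of_neg hs x
  rw [powApply, dif_pos h]
  revert h
  rw [rpow, if_neg hs.not_ge]
  intro h; rfl

/-- `A ^ (τ - r) A ^ (-τ) = A ^ (-r)` on the whole space, whatever the sign of `τ - r`. -/
theorem powApply_sub {τ r : ℝ} (hτ : 0 ≤ τ) (hr : 0 ≤ r) (w : H) :
    (A.inv ^ τ) w ∈ (A.rpow (τ - r)).domain ∧
      A.powApply (τ - r) ((A.inv ^ τ) w) = (A.inv ^ r) w := by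
  rcases le_or_gt r τ with h | h
  · have h1 : (A.inv ^ τ) w = (A.inv ^ (τ - r)) ((A.inv ^ r) w) := by
      rw [← ContinuousLinearMap.rpow_add_apply A.inv_nonneg (sub_nonneg.2 h) hr, sub_add_cancel]
    rw [h1]
    exact ⟨A.rpow_apply_mem (sub_nonneg.2 h) _, A.powApply_rpow (sub_nonneg.2 h) _⟩
  · have h' : τ - r < 0 := sub_neg.2 h
    refine ⟨A.mem_rpow_domain_of_neg h' _, ?_⟩
    rw [A.powApply_of_neg h', ← ContinuousLinearMap.rpow_add_apply A.inv_nonneg (by linarith) hτ]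
    congr 2; ring

theorem inner_rpow_half (x y : H) :
    inner ℂ ((A.inv ^ (1 / 2 : ℝ)) x) ((A.inv ^ (1 / 2 : ℝ)) y) = inner ℂ (A.inv x) y := by
  rw [← ContinuousLinearMap.inner_rpow, ← ContinuousLinearMap.rpow_add_apply A.inv_nonneg
    (by norm_num) (by norm_num), add_halves, CFC.rpow_one _ A.inv_nonneg]

end PosDefOp

/-! ### The Heinz inequality -/

theorem exp_add_of_commute_complex {𝔸 : Type*} [NormedRing 𝔸] [NormedAlgebra ℂ 𝔸]
    [CompleteSpace 𝔸] {x y : 𝔸} (h : Commute x y) :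
    NormedSpace.exp (x + y) = NormedSpace.exp x * NormedSpace.exp y := by
  let : NormedAlgebra ℚ 𝔸 := NormedAlgebra.restrictScalars ℚ ℂ 𝔸
  exact NormedSpace.exp_add_of_commute h

theorem exp_mem_unitary_of_mem_skewAdjoint_complex {𝔸 : Type*} [NormedRing 𝔸]
    [NormedAlgebra ℂ 𝔸] [CompleteSpace 𝔸] [StarRing 𝔸] [ContinuousStar 𝔸] {x : 𝔸}
    (h : x ∈ skewAdjoint 𝔸) : NormedSpace.exp x ∈ unitary 𝔸 := by
  let : NormedAlgebra ℚ 𝔸 := NormedAlgebra.restrictScalars ℚ ℂ 𝔸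
  exact NormedSpace.exp_mem_unitary_of_mem_skewAdjoint h

namespace ContinuousLinearMap

variable {H : Type*} [NormedAddCommGroup H] [InnerProductSpace ℂ H] [CompleteSpace H]
  {G : Type*} [NormedAddCommGroup G] [InnerProductSpace ℂ G] [CompleteSpace G]
  {T : H →L[ℂ] H}

theorem isStrictlyPositive_add_smul_one (hT : 0 ≤ T) {ε : ℝ} (hε : 0 < ε) :
    IsStrictlyPositive (T + ε • (1 : H →L[ℂ] H)) :=
  IsStrictlyPositive.nonneg_add hT (IsStrictlyPositive.smul hε isStrictlyPositive_one)

theorem tendsto_add_smul_one_rpow (hT : 0 ≤ T) {s : ℝ} (hs : 0 ≤ s) (x : H) :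
    Tendsto (fun ε : ℝ => ((T + ε • (1 : H →L[ℂ] H)) ^ s) x) (nhdsWithin 0 (Set.Ioi 0))
      (nhds ((T ^ s) x)) := by
  have h1 : ContinuousOn (fun ε : ℝ => cfc (fun r : ℝ => r ^ s) (T + ε • (1 : H →L[ℂ] H)))
      Set.univ := by
    refine ContinuousOn.cfc_of_mem_nhdsSet (s := Set.univ) _ Filter.univ_mem
      (by fun_prop) (fun ε _ => ?_) (Real.continuous_rpow_const hs).continuousOn
    exact hT.isSelfAdjoint.add (IsSelfAdjoint.smul (IsSelfAdjoint.all ε) (IsSelfAdjoint.one _))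
  have h2 := ((continuousOn_univ.1 h1).tendsto 0).mono_left
    (nhdsWithin_le_nhds (s := Set.Ioi (0 : ℝ)))
  rw [zero_smul, add_zero, ← CFC.rpow_eq_cfc_real hT] at h2
  have h3 := ((ContinuousLinearMap.apply ℂ H x).continuous.tendsto (T ^ s)).comp h2
  refine h3.congr' ?_
  filter_upwards [self_mem_nhdsWithin] with ε hε
  rw [CFC.rpow_eq_cfc_real (isStrictlyPositive_add_smul_one hT hε).nonneg]
  rfl

theorem exp_smul_log {S : H →L[ℂ] H} (hS : IsStrictlyPositive S) (t : ℝ) :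
    NormedSpace.exp (t • CFC.log S) = S ^ t := by
  have hpos : ∀ x ∈ _root_.spectrum ℝ S, 0 < x := fun x hx => hS.spectrum_pos hx
  have hlog : ContinuousOn Real.log (_root_.spectrum ℝ S) :=
    Real.continuousOn_log.mono fun x hx => (hpos x hx).ne'
  have hsa : IsSelfAdjoint S := hS.nonneg.isSelfAdjoint
  rw [CFC.rpow_eq_cfc_real hS.nonneg, CFC.log, ← cfc_smul t Real.log S hlog,
    ← CFC.real_exp_eq_normedSpace_exp (cfc_predicate _ _),
    ← cfc_comp' Real.exp (fun x => t • Real.log x) S Real.continuous_exp.continuousOn]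
  refine cfc_congr fun x hx => ?_
  simp only [smul_eq_mul]
  rw [Real.rpow_def_of_pos (hpos x hx), mul_comm]

/-- For selfadjoint `L`, the operator `exp (i y L)` is unitary. -/
theorem norm_exp_smul_le {L : H →L[ℂ] H} (hL : IsSelfAdjoint L) (z : ℂ) (x : H) :
    ‖NormedSpace.exp (z • L) x‖ ≤ ‖NormedSpace.exp (z.re • L) x‖ := by
  have h1 : z • L = ((z.im : ℂ) * Complex.I) • L + z.re • L := by
    rw [← Complex.coe_smul z.re L, ← add_smul, add_comm, Complex.re_add_im]
  have hc : Commute (((z.im : ℂ) * Complex.I) • L) (z.re • L) :=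
    ((Commute.refl L).smul_left _).smul_right _
  have hu : ((z.im : ℂ) * Complex.I) • L ∈ skewAdjoint (H →L[ℂ] H) := by
    rw [skewAdjoint.mem_iff, star_smul, hL.star_eq, ← neg_smul]
    simp
  rw [h1, exp_add_of_commute_complex hc]
  have hU := exp_mem_unitary_of_mem_skewAdjoint_complex hu
  generalize NormedSpace.exp (((z.im : ℂ) * Complex.I) • L) = U at hU
  exact (norm_map_of_mem_unitary hU (NormedSpace.exp (z.re • L) x)).le

theorem rpow_neg_apply_rpow {S : H →L[ℂ] H} (hS : IsStrictlyPositive S) (t : ℝ) (x : H) :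
    (S ^ (-t)) ((S ^ t) x) = x := by
  change (S ^ (-t) * S ^ t) x = x
  rw [CFC.rpow_neg_mul_rpow t hS]; rfl

theorem rpow_apply_rpow_neg {S : H →L[ℂ] H} (hS : IsStrictlyPositive S) (t : ℝ) (x : H) :
    (S ^ t) ((S ^ (-t)) x) = x := by
  simpa using rpow_neg_apply_rpow hS (-t) x

/-- The Heinz inequality for invertible operators: the three lines theorem is applied to the
bounded holomorphic function `z ↦ S ^ (-z) e N ^ z c`. -/
theorem norm_le_of_rpow_apply_eq_of_isStrictlyPositive {S : H →L[ℂ] H} {N : G →L[ℂ] G}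
    (hS : IsStrictlyPositive S) (hN : IsStrictlyPositive N) (e : G →L[ℂ] H) {D : ℝ}
    (h0 : ∀ c, ‖e c‖ ≤ D * ‖c‖) (h1 : ∀ c v, S v = e (N c) → ‖v‖ ≤ D * ‖c‖)
    {t : ℝ} (ht0 : 0 ≤ t) (ht1 : t ≤ 1) {c : G} {v : H} (hv : (S ^ t) v = e ((N ^ t) c)) :
    ‖v‖ ≤ D * ‖c‖ := by
  set L := CFC.log S
  set K := CFC.log N
  have hL : IsSelfAdjoint L := IsSelfAdjoint.log
  have hK : IsSelfAdjoint K := IsSelfAdjoint.log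
  let f : ℂ → H := fun z => NormedSpace.exp ((-z) • L) (e (NormedSpace.exp (z • K) c))
  have hfL : Differentiable ℂ (fun z : ℂ => NormedSpace.exp ((-z) • L)) := fun z =>
    ((hasDerivAt_exp_smul_const L (-z)).differentiableAt).comp z differentiable_neg.differentiableAt
  have hfK : Differentiable ℂ (fun z : ℂ => NormedSpace.exp (z • K)) := fun z =>
    (hasDerivAt_exp_smul_const K z).differentiableAt
  have hf : Differentiable ℂ f := by
    have h2 : Differentiable ℂ (fun z : ℂ => e (NormedSpace.exp (z • K) c)) :=
      e.differentiable.comp (hfK.clm_apply (differentiable_const c))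
    exact hfL.clm_apply h2
  have hD : 0 ≤ D * ‖c‖ := (norm_nonneg _).trans (h0 c)
  have hLle : ∀ (z : ℂ) (w : H), ‖NormedSpace.exp ((-z) • L) w‖ ≤ ‖(S ^ (-z.re)) w‖ := by
    intro z w
    have := norm_exp_smul_le hL (-z) w
    rwa [Complex.neg_re, exp_smul_log hS] at this
  have hKle : ∀ (z : ℂ), ‖NormedSpace.exp (z • K) c‖ ≤ ‖(N ^ z.re) c‖ := by
    intro z
    have := norm_exp_smul_le hK z c
    rwa [exp_smul_log hN] at this
  have hbd : BddAbove ((norm ∘ f) '' Complex.HadamardThreeLines.verticalClosedStrip 0 1) := by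
    have hc : Continuous fun x : ℝ => ‖S ^ (-x)‖ * (‖e‖ * ‖(N ^ x) c‖) := by
      have h3 : Continuous fun x : ℝ => S ^ (-x) := by
        have := (hfL.continuous.comp Complex.continuous_ofReal)
        refine this.congr fun x => ?_
        simp only [Function.comp]
        rw [← exp_smul_log hS, ← Complex.ofReal_neg, Complex.coe_smul]
      have h4 : Continuous fun x : ℝ => N ^ x := by
        have := (hfK.continuous.comp Complex.continuous_ofReal)
        refine this.congr fun x => ?_
        simp only [Function.comp]
        rw [← exp_smul_log hN, Complex.coe_smul]
      exact h3.norm.mul (continuous_const.mul (h4.clm_apply continuous_const).norm)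
    obtain ⟨B, hB⟩ := isCompact_Icc (a := (0 : ℝ)) (b := 1) |>.exists_bound_of_continuousOn
      hc.continuousOn
    refine ⟨B, ?_⟩
    rintro _ ⟨z, hz, rfl⟩
    refine le_trans ?_ ((le_abs_self _).trans (hB z.re hz))
    calc ‖f z‖ ≤ ‖(S ^ (-z.re)) (e (NormedSpace.exp (z • K) c))‖ := hLle z _
      _ ≤ ‖S ^ (-z.re)‖ * ‖e (NormedSpace.exp (z • K) c)‖ := le_opNorm _ _
      _ ≤ ‖S ^ (-z.re)‖ * (‖e‖ * ‖(N ^ z.re) c‖) := by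
        gcongr
        exact (le_opNorm _ _).trans (by gcongr; exact hKle z)
  have hzero : ∀ z ∈ Complex.re ⁻¹' {(0 : ℝ)}, ‖f z‖ ≤ D * ‖c‖ := by
    intro z hz
    have hz : z.re = 0 := hz
    have h2 := hLle z (e (NormedSpace.exp (z • K) c))
    have h3 := hKle z
    rw [hz, neg_zero, CFC.rpow_zero _ hS.nonneg] at h2
    rw [hz, CFC.rpow_zero _ hN.nonneg] at h3
    have hD' : ‖e (NormedSpace.exp (z • K) c)‖ ≤ D * ‖NormedSpace.exp (z • K) c‖ := h0 _
    rcases le_or_gt 0 D with h | h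
    · exact h2.trans (hD'.trans (mul_le_mul_of_nonneg_left h3 h))
    · have h4 : ‖c‖ = 0 := le_antisymm (by nlinarith) (norm_nonneg c)
      have h5 : c = 0 := norm_eq_zero.1 h4
      simp [f, h5]
  have hone : ∀ z ∈ Complex.re ⁻¹' {(1 : ℝ)}, ‖f z‖ ≤ D * ‖c‖ := by
    intro z hz
    have hz : z.re = 1 := hz
    have h2 := hLle z (e (NormedSpace.exp (z • K) c))
    have hz' : z • K = (1 : ℝ) • K + ((z.im : ℂ) * Complex.I) • K := by
      rw [← Complex.coe_smul, ← add_smul, ← hz, Complex.re_add_im]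
    have hc : Commute ((1 : ℝ) • K) (((z.im : ℂ) * Complex.I) • K) :=
      ((Commute.refl K).smul_left _).smul_right _
    set d := NormedSpace.exp (((z.im : ℂ) * Complex.I) • K) c with hd
    have h3 : NormedSpace.exp (z • K) c = N d := by
      rw [hz', exp_add_of_commute_complex hc, exp_smul_log hN, CFC.rpow_one _ hN.nonneg]; rfl
    have h4 : ‖d‖ ≤ ‖c‖ := by
      have := norm_exp_smul_le hK ((z.im : ℂ) * Complex.I) c
      simpa using this
    rw [hz, h3] at h2
    have h5 := h1 d ((S ^ (-1 : ℝ)) (e (N d))) (by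
      have := rpow_apply_rpow_neg hS 1 (e (N d))
      rwa [CFC.rpow_one _ hS.nonneg] at this)
    have h6 : ‖f z‖ ≤ D * ‖d‖ := by
      refine le_trans ?_ (h2.trans h5)
      simp only [f, h3]; exact le_rfl
    rcases le_or_gt 0 D with h | h
    · exact h6.trans (mul_le_mul_of_nonneg_left h4 h)
    · nlinarith [norm_nonneg d, norm_nonneg (f z)]
  have h2 := Complex.HadamardThreeLines.norm_le_interp_of_mem_verticalClosedStrip₀₁' f
    (z := (t : ℂ)) (by simp [Complex.HadamardThreeLines.verticalClosedStrip, ht0, ht1])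
    hf.diffContOnCl hbd hzero hone
  have h3 : f t = v := by
    simp only [f]
    rw [← Complex.ofReal_neg, Complex.coe_smul, Complex.coe_smul, exp_smul_log hS,
      exp_smul_log hN, ← hv, rpow_neg_apply_rpow hS]
  rw [h3, Complex.ofReal_re, ← Real.rpow_add_of_nonneg hD (sub_nonneg.2 ht1) ht0] at h2
  simpa using h2

/-- The **Heinz inequality**, in terms of the bounded inverses `T` and `N` of two positive
operators in different spaces: a bound for `T⁻¹ e N` interpolates to `T ^ (-t) e N ^ t`. -/
theorem exists_norm_le_of_rpow_apply_eq {N : G →L[ℂ] G} (hT : 0 ≤ T)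
    (hi : Function.Injective T) (hN : 0 ≤ N) (e : G →L[ℂ] H) {C : ℝ}
    (hC : ∀ c, ∃ w, T w = e (N c) ∧ ‖w‖ ≤ C * ‖c‖) {t : ℝ} (ht0 : 0 ≤ t) (ht1 : t ≤ 1) :
    ∃ D : ℝ, ∀ c v, (T ^ t) v = e ((N ^ t) c) → ‖v‖ ≤ D * ‖c‖ := by
  refine ⟨2 * |C| + ‖e‖, fun c v hv => ?_⟩
  set D := 2 * |C| + ‖e‖
  have hD : 0 ≤ D := by positivity
  -- the regularized operators `T + ε` and `N + ε` satisfy the hypotheses uniformly in `ε`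
  have hreg : ∀ ε : ℝ, 0 < ε → ∀ y : H,
      ‖inner ℂ y (e (((N + ε • (1 : G →L[ℂ] G)) ^ t) c))‖ ≤
        ‖((T + ε • (1 : H →L[ℂ] H)) ^ t) y‖ * (D * ‖c‖) := by
    intro ε hε y
    have hS := isStrictlyPositive_add_smul_one hT hε
    have hN' := isStrictlyPositive_add_smul_one hN hε
    set S := T + ε • (1 : H →L[ℂ] H) with hSdef
    set N' := N + ε • (1 : G →L[ℂ] G) with hNdef
    have h1 : ∀ c v, S v = e (N' c) → ‖v‖ ≤ D * ‖c‖ := by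
      intro c v hv
      obtain ⟨w, hw, hwC⟩ := hC c
      have hv' : T v + ε • v = T w + ε • e c := by
        rw [hw, ← map_smul_of_tower e, ← map_add]; exact hv
      have hd : T (v - w) = ε • (e c - v) := by
        rw [map_sub, smul_sub, sub_eq_sub_iff_add_eq_add, hv', add_comm]
      have hp := ((nonneg_iff_isPositive T).1 hT).2 (v - w)
      rw [reApplyInnerSelf_apply, hd, inner_smul_left_eq_smul] at hp
      have hp2 : 0 ≤ (inner ℂ (e c - v) (v - w)).re := by
        rw [RCLike.re_to_complex, Complex.smul_re, smul_eq_mul] at hp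
        exact nonneg_of_mul_nonneg_right hp hε
      have h4 : e c - v = (e c - w) - (v - w) := by abel
      rw [h4, inner_sub_left, Complex.sub_re] at hp2
      have h5 : (inner ℂ (v - w) (v - w)).re = ‖v - w‖ ^ 2 := inner_self_eq_norm_sq (𝕜 := ℂ) _
      have h6 : (inner ℂ (e c - w) (v - w)).re ≤ ‖e c - w‖ * ‖v - w‖ :=
        (Complex.re_le_norm _).trans (norm_inner_le_norm _ _)
      have h7 : ‖v - w‖ ≤ ‖e c - w‖ := by
        rcases (norm_nonneg (v - w)).eq_or_lt with h | h
        · rw [← h]; positivity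
        · exact le_of_mul_le_mul_right (by nlinarith) h
      have h8 : ‖v‖ ≤ ‖v - w‖ + ‖w‖ := by simpa using norm_add_le (v - w) w
      have h9 := norm_sub_le (e c) w
      have h10 := e.le_opNorm c
      have h11 : C * ‖c‖ ≤ |C| * ‖c‖ := by gcongr; exact le_abs_self C
      have : D * ‖c‖ = 2 * (|C| * ‖c‖) + ‖e‖ * ‖c‖ := by ring
      linarith
    have h0 : ∀ c, ‖e c‖ ≤ D * ‖c‖ := fun c => (e.le_opNorm c).trans (by
      gcongr; simp only [D]; linarith [abs_nonneg C])
    set v' := (S ^ (-t)) (e ((N' ^ t) c)) with hv'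
    have h2 : (S ^ t) v' = e ((N' ^ t) c) := rpow_apply_rpow_neg hS t _
    have h3 := norm_le_of_rpow_apply_eq_of_isStrictlyPositive hS hN' e h0 h1 ht0 ht1 h2
    rw [← h2, ← inner_rpow]
    exact (norm_inner_le_norm _ _).trans (by gcongr)
  have hlim : ∀ y : H, ‖inner ℂ y (e ((N ^ t) c))‖ ≤ ‖(T ^ t) y‖ * (D * ‖c‖) := by
    intro y
    have ha := (tendsto_const_nhds (x := y)).inner (𝕜 := ℂ)
      ((e.continuous.tendsto _).comp (tendsto_add_smul_one_rpow hN ht0 c))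
    have hb := ((tendsto_add_smul_one_rpow hT ht0 y).norm).mul_const (D * ‖c‖)
    refine le_of_tendsto_of_tendsto ha.norm hb ?_
    filter_upwards [self_mem_nhdsWithin] with ε hε
    exact hreg ε hε y
  have hdual : ∀ x : H, ‖inner ℂ x v‖ ≤ ‖x‖ * (D * ‖c‖) := by
    intro x
    refine (denseRange_rpow hT hi ht0).induction_on (p := fun x => ‖inner ℂ x v‖ ≤ ‖x‖ * (D * ‖c‖))
      x (isClosed_le (by fun_prop) (by fun_prop)) fun y => ?_
    rw [inner_rpow, hv]
    exact hlim y
  have h := hdual v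
  have h' : ‖v‖ * ‖v‖ ≤ ‖v‖ * (D * ‖c‖) :=
    (inner_self_eq_norm_mul_norm (𝕜 := ℂ) v).symm.le.trans ((RCLike.re_le_norm _).trans h)
  rcases (norm_nonneg v).eq_or_lt with h0 | h0
  · rw [← h0]; positivity
  · exact le_of_mul_le_mul_left h' h0

end ContinuousLinearMap

/-! ### Fourier expansion in the eigenvectors of `M` -/

namespace PosDefOp

variable {G : Type*} [NormedAddCommGroup G] [InnerProductSpace ℂ G] [CompleteSpace G]
  (M : PosDefOp G)

namespace IsLowestEigenpairs

variable {M} {ι : Type*} [LinearOrder ι] {μ : ι → ℝ} {q : ι → G}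

theorem ne_zero (h : M.IsLowestEigenpairs μ q) (k : ι) : q k ≠ 0 := h.orthonormal.ne_zero k

theorem pos (h : M.IsLowestEigenpairs μ q) (k : ι) : 0 < μ k :=
  M.pos_of_isEigen (h.ne_zero k) (h.eigen k)

theorem inv_apply (h : M.IsLowestEigenpairs μ q) (k : ι) :
    M.inv (q k) = (((μ k)⁻¹ : ℝ) : ℂ) • q k :=
  M.inv_apply_of_isEigen (h.ne_zero k) (h.eigen k)

theorem inv_rpow_apply (h : M.IsLowestEigenpairs μ q) {s : ℝ} (hs : 0 ≤ s) (k : ι) :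
    (M.inv ^ s) (q k) = ((μ k ^ (-s) : ℝ) : ℂ) • q k := by
  rw [ContinuousLinearMap.rpow_apply_of_eigenvector M.inv_nonneg hs (h.inv_apply k),
    Real.rpow_neg (h.pos k).le, Real.inv_rpow (h.pos k).le]

end IsLowestEigenpairs

/-- Eigenvectors whose eigenvalues exhaust the bottom of the spectrum and tend to infinity are
complete: a nonzero orthogonal complement would contain a further eigenvector, by the spectral
theorem for the compact operator `M⁻¹` restricted to it. -/
theorem orthogonal_span_eigenvectors_eq_bot (hM : IsCompactOperator M.inv) {μ : ℕ → ℝ}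
    {q : ℕ → G} (h : M.IsLowestEigenpairs μ q) (hμ : Tendsto μ atTop atTop) :
    (Submodule.span ℂ (Set.range q))ᗮ = ⊥ := by
  set S := (Submodule.span ℂ (Set.range q))ᗮ with hS
  have hmem : ∀ x, x ∈ S ↔ ∀ k, inner ℂ (q k) x = 0 := by
    intro x
    rw [hS, Submodule.mem_orthogonal]
    constructor
    · exact fun hx k => hx _ (Submodule.subset_span ⟨k, rfl⟩)
    · intro hx u hu
      induction hu using Submodule.span_induction with
      | mem v hv => obtain ⟨k, rfl⟩ := hv; exact hx k
      | zero => simp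
      | add a b _ _ ha hb => rw [inner_add_left, ha, hb, add_zero]
      | smul c a _ ha => rw [inner_smul_left, ha, mul_zero]
  have hinv : ∀ x ∈ S, M.inv x ∈ S := by
    intro x hx
    rw [hmem] at hx ⊢
    intro k
    rw [← ContinuousLinearMap.inner_left_eq_right_of_nonneg M.inv_nonneg, h.inv_apply k,
      inner_smul_left, hx k, mul_zero]
  have hsymm : M.inv.IsSymmetric :=
    ((ContinuousLinearMap.nonneg_iff_isPositive M.inv).1 M.inv_nonneg).isSymmetric
  let R : S →L[ℂ] S := M.inv.restrict hinv
  have hRc : IsCompactOperator R := hM.restrict' hinv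
  have hRs : R.IsSymmetric := hsymm.restrict_invariant hinv
  have hbot : ∀ κ, Module.End.eigenspace (R : Module.End ℂ S) κ = ⊥ := by
    intro κ
    rw [Submodule.eq_bot_iff]
    intro w hw
    by_contra hw0
    have hev : Module.End.HasEigenvalue (R : Module.End ℂ S) κ :=
      Module.End.hasEigenvalue_of_hasEigenvector ⟨hw, hw0⟩
    have hκr : ((κ.re : ℝ) : ℂ) = κ := Complex.conj_eq_iff_re.1 (hRs.conj_eigenvalue_eq_self hev)
    have hw' : M.inv (w : G) = κ • (w : G) :=
      congrArg Subtype.val (Module.End.mem_eigenspace_iff.1 hw)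
    have hwG : (w : G) ≠ 0 := fun h0 => hw0 (Subtype.ext h0)
    have hκ : κ ≠ 0 := by
      rintro rfl
      rw [zero_smul] at hw'
      exact hwG (M.inv_injective (hw'.trans (map_zero _).symm))
    have he : M.IsEigen (((κ.re)⁻¹ : ℝ) : ℂ) (w : G) := by
      rw [Complex.ofReal_inv, hκr, M.isEigen_iff (inv_ne_zero hκ), inv_inv, hw']
    have hle := h.lowest _ _ hwG he ((hmem _).1 w.2)
    obtain ⟨k, hk⟩ := (hμ.eventually_gt_atTop (κ.re)⁻¹).exists
    exact absurd (hle k) hk.not_ge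
  have h1 := ContinuousLinearMap.orthogonalComplement_iSup_eigenspaces_eq_bot hRc hRs
  simp only [hbot, iSup_bot, Submodule.bot_orthogonal_eq_top] at h1
  rw [← Submodule.subsingleton_iff_eq_bot]
  exact (Submodule.subsingleton_iff ℂ).1 (subsingleton_of_bot_eq_top h1.symm)

/-- The Fourier remainder of an element of the domain of `M ^ s` with respect to the eigenvectors
of `M` is of smaller order than `μ n ^ (-s)`. -/
theorem isLittleO_sub_sum_inner (hM : IsCompactOperator M.inv) {μ : ℕ → ℝ}
    {q : ℕ → G} (h : M.IsLowestEigenpairs μ q) (hμ : Tendsto μ atTop atTop)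
    {s : ℝ} (hs : 0 ≤ s) (y : G) :
    (fun n => ‖(M.inv ^ s) y - ∑ k ∈ Finset.range n, inner ℂ (q k) ((M.inv ^ s) y) • q k‖)
      =o[atTop] fun n => μ n ^ (-s) := by
  set b : HilbertBasis ℕ ℂ G := HilbertBasis.mkOfOrthogonalEqBot h.orthonormal
    (M.orthogonal_span_eigenvectors_eq_bot hM h hμ) with hb
  have hbq : ∀ k, b k = q k := fun k => by rw [hb, HilbertBasis.coe_mkOfOrthogonalEqBot]
  have hcoord : ∀ z k, inner ℂ (q k) ((M.inv ^ s) z) = ((μ k ^ (-s) : ℝ) : ℂ) * inner ℂ (q k) z := by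
    intro z k
    rw [← ContinuousLinearMap.inner_rpow, h.inv_rpow_apply hs, inner_smul_left, Complex.conj_ofReal]
  have hnorm : ∀ z : G, HasSum (fun k => ‖inner ℂ (q k) z‖ ^ 2) (‖z‖ ^ 2) := by
    intro z
    convert Complex.hasSum_re (b.hasSum_inner_mul_inner z z) using 1
    · funext k
      rw [hbq, ← RCLike.re_to_complex, inner_mul_symm_re_eq_norm, norm_mul,
        norm_inner_symm z, sq]
    · exact (inner_self_eq_norm_sq (𝕜 := ℂ) z).symm
  set z : ℕ → G := fun n => y - ∑ k ∈ Finset.range n, inner ℂ (q k) y • q k with hz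
  have hz0 : Tendsto (fun n => ‖z n‖) atTop (nhds 0) := by
    have h1 := (b.hasSum_repr y).tendsto_sum_nat
    have h2 := (tendsto_const_nhds (x := y)).sub h1
    rw [sub_self] at h2
    have h3 := h2.norm
    rw [norm_zero] at h3
    refine h3.congr fun n => ?_
    simp only [hz, HilbertBasis.repr_apply_apply, hbq]
  have hzk : ∀ n k, k < n → inner ℂ (q k) (z n) = 0 := by
    intro n k hk
    simp only [hz]
    rw [inner_sub_right, h.orthonormal.inner_right_sum _ (Finset.mem_range.2 hk), sub_self]
  have heq : ∀ n, (M.inv ^ s) y - ∑ k ∈ Finset.range n, inner ℂ (q k) ((M.inv ^ s) y) • q k =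
      (M.inv ^ s) (z n) := by
    intro n
    simp only [hz]
    rw [map_sub, map_sum]
    congr 1
    refine Finset.sum_congr rfl fun k _ => ?_
    rw [map_smul, h.inv_rpow_apply hs, hcoord, smul_smul, mul_comm]
  have hle : ∀ n, ‖(M.inv ^ s) (z n)‖ ≤ μ n ^ (-s) * ‖z n‖ := by
    intro n
    have hp : 0 ≤ μ n ^ (-s) := Real.rpow_nonneg (h.pos n).le _
    refine le_of_sq_le_sq ?_ (by positivity)
    rw [mul_pow]
    refine hasSum_le (fun k => ?_) (hnorm _) ((hnorm (z n)).mul_left _)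
    rw [hcoord, norm_mul, mul_pow]
    rcases lt_or_ge k n with hk | hk
    · rw [hzk n k hk]; simp
    · gcongr
      rw [Complex.norm_real, Real.norm_of_nonneg (Real.rpow_nonneg (h.pos k).le _)]
      exact Real.rpow_le_rpow_of_nonpos (h.pos n) (h.mono hk) (neg_nonpos.2 hs)
  have : (fun n => μ n ^ (-s) * ‖z n‖) =o[atTop] fun n => μ n ^ (-s) := by
    have h1 : (fun n => ‖z n‖) =o[atTop] fun _ => (1 : ℝ) := (isLittleO_one_iff ℝ).2 hz0
    simpa using (isBigO_refl (fun n => μ n ^ (-s)) atTop).mul_isLittleO h1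
  refine IsBigO.trans_isLittleO (IsBigO.of_bound 1 (Eventually.of_forall fun n => ?_)) this
  rw [heq, norm_norm, one_mul]
  exact (hle n).trans (le_abs_self _)

end PosDefOp

/-! ### The spectral gap below the essential spectrum -/

namespace ContinuousLinearMap

variable {H : Type*} [NormedAddCommGroup H] [InnerProductSpace ℂ H]
  {T : H →L[ℂ] H}

theorem inner_eq_zero_of_eigenvectors [CompleteSpace H] (hT : 0 ≤ T) {a b : ℝ} (hab : a ≠ b)
    {x y : H}
    (hx : T x = (a : ℂ) • x) (hy : T y = (b : ℂ) • y) : inner ℂ x y = 0 := by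
  have h := inner_left_eq_right_of_nonneg hT x y
  rw [hx, hy, inner_smul_left, inner_smul_right, Complex.conj_ofReal, ← sub_eq_zero,
    ← sub_mul] at h
  refine (mul_eq_zero.1 h).resolve_left ?_
  exact sub_ne_zero.2 (by exact_mod_cast hab)

theorem commute_starProjection_of_invariant [CompleteSpace H] (hT : 0 ≤ T) (L : Submodule ℂ H)
    [L.HasOrthogonalProjection] (hL : ∀ x ∈ L, T x ∈ L) : Commute T L.starProjection := by
  have h1 : ∀ x ∈ Lᗮ, T x ∈ Lᗮ := by
    intro x hx
    rw [Submodule.mem_orthogonal'] at hx ⊢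
    intro y hy
    rw [inner_left_eq_right_of_nonneg hT]
    exact hx _ (hL y hy)
  ext x
  change T (L.starProjection x) = L.starProjection (T x)
  refine (Submodule.eq_starProjection_of_mem_orthogonal
    (hL _ (L.starProjection_apply_mem x)) ?_).symm
  rw [← map_sub]
  exact h1 _ (L.sub_starProjection_mem_orthogonal x)

/-- If every `m ≥ κ` is isolated from the rest of the spectrum of `T` and is no eigenvalue of `T`
on the invariant subspace `L`, then `T` is bounded above on `L` by a constant below `κ`. Otherwise
`m = ‖T P‖ ≥ κ`, with `P` the projection onto `L`, would belong to the spectrum of `T P`,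
although the functional calculus of `T` provides an inverse of `T P - m`. -/
theorem exists_lt_re_inner_le [CompleteSpace H] (hT : 0 ≤ T) (L : Submodule ℂ H)
    [L.HasOrthogonalProjection]
    (hL : ∀ x ∈ L, T x ∈ L) {κ : ℝ} (hκ : 0 < κ)
    (hiso : ∀ m, κ ≤ m → ∃ ε > 0, ∀ r ∈ _root_.spectrum ℝ T, |r - m| < ε → r = m)
    (hker : ∀ m : ℝ, κ ≤ m → ∀ x ∈ L, T x = (m : ℂ) • x → x = 0) :
    ∃ κ' < κ, ∀ x ∈ L, (inner ℂ (T x) x).re ≤ κ' * ‖x‖ ^ 2 := by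
  set P := L.starProjection with hP
  have hTP : Commute T P := commute_starProjection_of_invariant hT L hL
  have hPP : P * P = P := L.isIdempotentElem_starProjection
  have hPsym : ∀ x y, inner ℂ (P x) y = inner ℂ x (P y) :=
    L.inner_starProjection_left_eq_right
  have hPL : ∀ x ∈ L, P x = x := fun x hx => Submodule.starProjection_eq_self_iff.2 hx
  rcases lt_or_ge ‖T * P‖ κ with hlt | hge
  · refine ⟨‖T * P‖, hlt, fun x hx => ?_⟩
    have h1 : T x = (T * P) x := by change _ = T (P x); rw [hPL x hx]
    rw [h1]
    calc _ ≤ ‖inner ℂ ((T * P) x) x‖ := Complex.re_le_norm _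
      _ ≤ ‖(T * P) x‖ * ‖x‖ := norm_inner_le_norm _ _
      _ ≤ ‖T * P‖ * ‖x‖ * ‖x‖ := by gcongr; exact le_opNorm _ _
      _ = _ := by ring
  exfalso
  set m := ‖T * P‖ with hm
  have hm0 : 0 < m := hκ.trans_le hge
  have hS : 0 ≤ T * P := by
    rw [nonneg_iff_isPositive]
    refine ⟨fun x y => ?_, fun x => ?_⟩
    · change inner ℂ (T (P x)) y = inner ℂ x (T (P y))
      rw [inner_left_eq_right_of_nonneg hT, hPsym]
      change inner ℂ x ((P * T) y) = inner ℂ x ((T * P) y)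
      rw [hTP.eq]
    · have h1 : (T * P) x = P (T (P x)) := by
        change _ = (P * T * P) x
        rw [← hTP.eq, mul_assoc, hPP]
      rw [reApplyInnerSelf_apply, h1, hPsym]
      exact ((nonneg_iff_isPositive T).1 hT).2 (P x)
  have hnt : Nontrivial (H →L[ℂ] H) :=
    ⟨T * P, 0, fun h => by rw [h, norm_zero] at hm; exact hm0.ne' hm⟩
  have hspec : m ∈ _root_.spectrum ℝ (T * P) := CStarAlgebra.norm_mem_spectrum_of_nonneg hS
  obtain ⟨ε, hε, hiso⟩ := hiso m hge
  -- a globally continuous function equal to `(r - m)⁻¹` off the `ε`-neighbourhood of `m`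
  let h : ℝ → ℝ := fun r => (r - m) / max ((r - m) ^ 2) (ε ^ 2)
  have hpos : ∀ r : ℝ, max ((r - m) ^ 2) (ε ^ 2) ≠ 0 := fun r =>
    (lt_max_of_lt_right (by positivity)).ne'
  have hcont : Continuous h := by
    refine Continuous.div (by fun_prop) (by fun_prop) hpos
  have hTsa : IsSelfAdjoint T := hT.isSelfAdjoint
  set B := cfc h T with hB
  set D := T - algebraMap ℝ (H →L[ℂ] H) m with hD
  have hDcfc : cfc (fun r : ℝ => r - m) T = D := by
    rw [cfc_sub (fun r : ℝ => r) (fun _ => m) T, cfc_id' ℝ T, cfc_const m T]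
  have hDDB : D * (D * B) = D := by
    rw [← hDcfc, hB, ← cfc_mul (fun r : ℝ => r - m) h T (by fun_prop) hcont.continuousOn,
      ← cfc_mul (fun r : ℝ => r - m) _ T (by fun_prop) (by fun_prop)]
    refine cfc_congr fun r hr => ?_
    rcases lt_or_ge |r - m| ε with hlt | hle
    · simp [hiso r hr hlt]
    · have h1 : ε ^ 2 ≤ (r - m) ^ 2 := by rw [← sq_abs (r - m)]; gcongr
      have h2 : (r - m) ≠ 0 := abs_pos.1 (hε.trans_le hle)
      simp only [h]
      rw [max_eq_left h1]
      field_simp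
  have hBP : Commute B P := hTsa.commute_cfc hTP h
  have hBT : Commute B T := hTsa.commute_cfc (Commute.refl T) h
  have hDP : Commute D P := hTP.sub_left (Algebra.commute_algebraMap_left _ _)
  have hDBP : D * B * P = P := by
    ext x
    have h1 : P x - (D * B * P) x ∈ L := by
      have : P x - (D * B * P) x = P (x - (D * B) x) := by
        rw [(hDP.mul_left hBP).eq, map_sub]; rfl
      rw [this]
      exact L.starProjection_apply_mem _
    have h2 : D (P x - (D * B * P) x) = 0 := by
      have : D * P - D * (D * B * P) = 0 := by
        rw [← mul_assoc D (D * B), hDDB, sub_self]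
      have := congrArg (fun F : H →L[ℂ] H => F x) this
      rw [map_sub]; exact this
    have h3 : T (P x - (D * B * P) x) = (m : ℂ) • (P x - (D * B * P) x) := by
      have h4 : ∀ v, D v = 0 → T v = (m : ℂ) • v := by
        intro v hv
        rw [hD, sub_apply, sub_eq_zero, Algebra.algebraMap_eq_smul_one] at hv
        rw [hv]
        simp
      exact h4 _ h2
    exact (sub_eq_zero.1 (hker m hge _ h1 h3)).symm
  have hinv : (T * P - algebraMap ℝ (H →L[ℂ] H) m) * (B * P - m⁻¹ • (1 - P)) = 1 := by
    have e1 : T * P * (B * P) = T * B * P := by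
      rw [mul_assoc, ← mul_assoc P, ← hBP.eq, mul_assoc B, hPP, mul_assoc]
    have e2 : T * P * (1 - P) = 0 := by
      rw [mul_sub, mul_one, mul_assoc, hPP, sub_self]
    have e3 : D * B * P = T * B * P - m • (B * P) := by
      rw [hD, Algebra.algebraMap_eq_smul_one, sub_mul, sub_mul, smul_mul_assoc, one_mul,
        smul_mul_assoc]
    rw [sub_mul, mul_sub, mul_sub, e1, mul_smul_comm, e2, smul_zero, sub_zero,
      Algebra.algebraMap_eq_smul_one, smul_mul_assoc, one_mul, mul_smul_comm, smul_mul_assoc,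
      one_mul, smul_smul, inv_mul_cancel₀ hm0.ne', one_smul, ← sub_add, ← e3, hDBP]
    abel
  have hcomm : Commute (T * P - algebraMap ℝ (H →L[ℂ] H) m) (B * P - m⁻¹ • (1 - P)) := by
    have c1 : Commute P (B * P - m⁻¹ • (1 - P)) :=
      ((hBP.symm).mul_right (Commute.refl P)).sub_right
        (((Commute.one_right P).sub_right (Commute.refl P)).smul_right _)
    have c2 : Commute T (B * P - m⁻¹ • (1 - P)) :=
      ((hBT.symm).mul_right hTP).sub_right
        (((Commute.one_right T).sub_right hTP).smul_right _)
    exact (c2.mul_left c1).sub_left (Algebra.commute_algebraMap_left _ _)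
  refine hspec ?_
  rw [spectrum.mem_resolventSet_iff, ← IsUnit.neg_iff, neg_sub]
  exact (hcomm.isUnit_mul_iff.1 (by rw [hinv]; exact isUnit_one)).1

end ContinuousLinearMap

namespace PosDefOp

variable {H : Type*} [NormedAddCommGroup H] [InnerProductSpace ℂ H] [CompleteSpace H]
  (A : PosDefOp H)

theorem inv_mem_spectrum {r : ℝ} (hr0 : r ≠ 0) (hr : r ∈ _root_.spectrum ℝ A.inv) :
    ((r⁻¹ : ℝ) : ℂ) ∈ A.spectrum := by
  rintro ⟨R, hR1, hR2⟩
  refine hr ?_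
  set z : ℂ := ((r⁻¹ : ℝ) : ℂ) with hz
  have hrz : (r : ℂ) * z = 1 := by rw [hz, ← Complex.ofReal_mul, mul_inv_cancel₀ hr0]; simp
  -- the resolvent of `A` at `z = 1 / r` gives that of `A⁻¹` at `r`
  have key1 : ∀ y, (r : ℂ) • (z • (y + z • R y)) - A.inv (z • (y + z • R y)) = y := by
    intro y
    obtain ⟨hd, he⟩ := hR1 y
    have h1 : y + z • R y = A.op ⟨R y, hd⟩ := by
      have := sub_eq_iff_eq_add.1 he
      rw [this]
    have h2 : A.inv (y + z • R y) = R y := by rw [h1, A.inv_op]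
    rw [map_smul, h2, smul_smul, hrz, one_smul]
    abel
  have key2 : ∀ y, z • (((r : ℂ) • y - A.inv y) + z • R ((r : ℂ) • y - A.inv y)) = y := by
    intro y
    have h1 := hR2 ⟨A.inv y, A.inv_mem y⟩
    rw [A.op_inv] at h1
    have h2 : (r : ℂ) • y - A.inv y = (r : ℂ) • (y - z • A.inv y) := by
      rw [smul_sub, smul_smul, hrz, one_smul]
    rw [h2, map_smul, h1, ← h2, smul_comm z (r : ℂ), smul_smul, hrz, one_smul, sub_add_cancel,
      smul_smul, mul_comm, hrz, one_smul]
  rw [spectrum.mem_resolventSet_iff, Algebra.algebraMap_eq_smul_one]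
  let F : H →L[ℂ] H := z • (1 + z • R)
  refine ⟨⟨r • (1 : H →L[ℂ] H) - A.inv, F, ?_, ?_⟩, rfl⟩
  · ext y
    have := key1 y
    simpa [F] using this
  · ext y
    have := key2 y
    simpa [F] using this

/-- The spectral gap: below the essential spectrum, `A⁻¹` is bounded by a constant less than
`1 / lam j` on the complement of the `lam j`-eigenspace and of the lower eigenvectors in the
list. -/
theorem IsLowestEigenpairs.exists_gap {A : PosDefOp H} {ℓ : ℕ} {lam : Fin ℓ → ℝ} {u : Fin ℓ → H}
    (h : A.IsLowestEigenpairs lam u) (hess : ∀ j, ∀ z ∈ A.essSpectrum, lam j < z.re)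
    (j : Fin ℓ) :
    ∃ κ' < (lam j)⁻¹, ∀ x : H, (∀ i, lam i < lam j → inner ℂ (u i) x = 0) →
      (∀ w, A.inv w = (((lam j)⁻¹ : ℝ) : ℂ) • w → inner ℂ w x = 0) →
      (inner ℂ (A.inv x) x).re ≤ κ' * ‖x‖ ^ 2 := by
  set T := A.inv with hTdef
  have hT : 0 ≤ T := A.inv_nonneg
  have hκ : 0 < (lam j)⁻¹ := inv_pos.2 (h.pos j)
  set E : Set H := {w | (∃ i, lam i < lam j ∧ w = u i) ∨ T w = (((lam j)⁻¹ : ℝ) : ℂ) • w} with hE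
  set L := (Submodule.span ℂ E)ᗮ with hLdef
  have hmem : ∀ x, x ∈ L ↔ ∀ w ∈ E, inner ℂ w x = 0 := by
    intro x
    rw [hLdef, Submodule.mem_orthogonal]
    constructor
    · exact fun hx w hw => hx _ (Submodule.subset_span hw)
    · intro hx w hw
      induction hw using Submodule.span_induction with
      | mem v hv => exact hx v hv
      | zero => simp
      | add a b _ _ ha hb => rw [inner_add_left, ha, hb, add_zero]
      | smul c a _ ha => rw [inner_smul_left, ha, mul_zero]
  have hL : ∀ x ∈ L, T x ∈ L := by
    intro x hx
    rw [hmem] at hx ⊢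
    intro w hw
    have hev : ∃ c : ℂ, T w = c • w := by
      rcases hw with ⟨i, -, rfl⟩ | hw
      · exact ⟨_, h.inv_apply i⟩
      · exact ⟨_, hw⟩
    obtain ⟨c, hc⟩ := hev
    rw [← ContinuousLinearMap.inner_left_eq_right_of_nonneg hT, hc, inner_smul_left, hx w hw,
      mul_zero]
  have hiso : ∀ m, (lam j)⁻¹ ≤ m → ∃ ε > 0, ∀ r ∈ _root_.spectrum ℝ T, |r - m| < ε → r = m := by
    intro m hm
    have hm0 : 0 < m := hκ.trans_le hm
    by_cases hms : m ∈ _root_.spectrum ℝ T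
    · have hz := A.inv_mem_spectrum hm0.ne' hms
      have hne : ((m⁻¹ : ℝ) : ℂ) ∉ A.essSpectrum := fun hc => by
        have h1 := hess j _ hc
        rw [Complex.ofReal_re] at h1
        exact absurd (inv_le_of_inv_le₀ (h.pos j) hm) h1.not_ge
      have h1 : ∃ ε > 0, ∀ z' ∈ A.spectrum, dist z' ((m⁻¹ : ℝ) : ℂ) < ε →
          z' = ((m⁻¹ : ℝ) : ℂ) := by
        by_contra hc
        exact hne ⟨hz, fun h2 => hc h2.1⟩
      obtain ⟨ε, hε, h1⟩ := h1
      have hc : ContinuousAt (fun r : ℝ => r⁻¹) m := continuousAt_inv₀ hm0.ne'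
      obtain ⟨δ, hδ, h2⟩ := Metric.continuousAt_iff.1 hc ε hε
      refine ⟨min δ m, lt_min hδ hm0, fun r hr hrm => ?_⟩
      have hr0 : r ≠ 0 := by
        rintro rfl
        have := hrm.trans_le (min_le_right _ _)
        rw [zero_sub, abs_neg, abs_of_pos hm0] at this
        exact lt_irrefl _ this
      have h3 := h1 _ (A.inv_mem_spectrum hr0 hr) (by
        rw [Complex.dist_eq, ← Complex.ofReal_sub, Complex.norm_real]
        exact h2 (by rw [Real.dist_eq]; exact hrm.trans_le (min_le_left _ _)))
      exact _root_.inv_injective (by exact_mod_cast h3)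
    · have hopen : IsOpen (_root_.spectrum ℝ T)ᶜ := (spectrum.isClosed T).isOpen_compl
      obtain ⟨ε, hε, hb⟩ := Metric.isOpen_iff.1 hopen m hms
      refine ⟨ε, hε, fun r hr hrm => absurd hr (hb ?_)⟩
      rwa [Metric.mem_ball, Real.dist_eq]
  have hker : ∀ m : ℝ, (lam j)⁻¹ ≤ m → ∀ x ∈ L, T x = (m : ℂ) • x → x = 0 := by
    intro m hm x hx hTx
    have hm0 : 0 < m := hκ.trans_le hm
    rw [hmem] at hx
    rcases hm.eq_or_lt with rfl | hlt
    · exact inner_self_eq_zero.1 (hx x (Or.inr hTx))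
    · by_contra hx0
      have he : A.IsEigen ((m⁻¹ : ℝ) : ℂ) x := by
        rw [A.isEigen_iff (by exact_mod_cast (inv_pos.2 hm0).ne'), Complex.ofReal_inv, inv_inv]
        exact hTx
      have hlt' : m⁻¹ < lam j := inv_lt_of_inv_lt₀ (h.pos j) hlt
      refine absurd (h.lowest _ x hx0 he (fun i => ?_) j) hlt'.not_ge
      rcases lt_or_ge (lam i) (lam j) with hi | hi
      · exact hx _ (Or.inl ⟨i, hi, rfl⟩)
      · refine ContinuousLinearMap.inner_eq_zero_of_eigenvectors hT ?_ (h.inv_apply i) hTx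
        exact ((inv_anti₀ (h.pos j) hi).trans_lt hlt).ne
  obtain ⟨κ', hκ', hle⟩ := ContinuousLinearMap.exists_lt_re_inner_le hT L hL hκ hiso hker
  refine ⟨κ', hκ', fun x h1 h2 => hle x ((hmem x).2 ?_)⟩
  rintro w (⟨i, hi, rfl⟩ | hw)
  · exact h1 i hi
  · exact h2 w hw

end PosDefOp

/-! ### Finite orthogonal systems -/

/-- A homogeneous linear system with more unknowns than equations has a nonzero solution. -/
theorem exists_ne_zero_forall_sum_mul_eq_zero {m : ℕ} (a : Fin m → Fin (m + 1) → ℂ) :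
    ∃ c : Fin (m + 1) → ℂ, c ≠ 0 ∧ ∀ k, ∑ i, c i * a k i = 0 := by
  have h : LinearMap.ker (Matrix.mulVecLin (Matrix.of a)) ≠ ⊥ :=
    LinearMap.ker_ne_bot_of_finrank_lt (by simp)
  obtain ⟨c, hc, hc0⟩ := Submodule.exists_mem_ne_zero_of_ne_bot h
  refine ⟨c, hc0, fun k => ?_⟩
  have := congrFun (LinearMap.mem_ker.1 hc) k
  simpa [Matrix.mulVec, dotProduct, mul_comm] using this

theorem sum_norm_sq_pos {ι : Type*} [Fintype ι] {c : ι → ℂ} (hc : c ≠ 0) :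
    0 < ∑ i, ‖c i‖ ^ 2 := by
  obtain ⟨i, hi⟩ := Function.ne_iff.1 hc
  exact Finset.sum_pos' (fun _ _ => by positivity)
    ⟨i, Finset.mem_univ i, by have := norm_pos_iff.2 hi; positivity⟩

theorem norm_sum_smul_sq_le {E ι : Type*} [NormedAddCommGroup E] [NormedSpace ℂ E] [Fintype ι]
    (c : ι → ℂ) (v : ι → E) {δ : ℝ} (hv : ∀ i, ‖v i‖ ≤ δ) :
    ‖∑ i, c i • v i‖ ^ 2 ≤ Fintype.card ι * δ ^ 2 * ∑ i, ‖c i‖ ^ 2 := by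
  calc ‖∑ i, c i • v i‖ ^ 2 ≤ (∑ i, ‖c i‖ * δ) ^ 2 := by
        gcongr
        refine (norm_sum_le _ _).trans (Finset.sum_le_sum fun i _ => ?_)
        rw [norm_smul]
        gcongr
        exact hv i
    _ ≤ Fintype.card ι * ∑ i, (‖c i‖ * δ) ^ 2 := sq_sum_le_card_mul_sum_sq
    _ = _ := by simp only [mul_pow]; rw [← Finset.sum_mul]; ring

section GramSums

variable {H : Type*} [NormedAddCommGroup H] [InnerProductSpace ℂ H]

theorem inner_sum_smul_sum_smul_of_orthogonal {ι : Type*} [DecidableEq ι] (s : Finset ι)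
    (a b : ι → ℂ) (v w : ι → H) (d : ι → ℂ)
    (h : ∀ i j, inner ℂ (v i) (w j) = if i = j then d i else 0) :
    inner ℂ (∑ i ∈ s, a i • v i) (∑ j ∈ s, b j • w j) =
      ∑ i ∈ s, starRingEnd ℂ (a i) * b i * d i := by
  rw [sum_inner]
  refine Finset.sum_congr rfl fun i hi => ?_
  rw [inner_sum, Finset.sum_eq_single_of_mem i hi]
  · rw [inner_smul_left, inner_smul_right, h, if_pos rfl, mul_assoc]
  · intro j _ hj
    rw [inner_smul_left, inner_smul_right, h, if_neg hj.symm, mul_zero, mul_zero]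

theorem re_inner_sum_smul_sum_smul_of_orthogonal {ι : Type*} [DecidableEq ι] (s : Finset ι)
    (a : ι → ℂ) (v w : ι → H) (d : ι → ℝ)
    (h : ∀ i j, inner ℂ (v i) (w j) = if i = j then (d i : ℂ) else 0) :
    (inner ℂ (∑ i ∈ s, a i • v i) (∑ j ∈ s, a j • w j)).re = ∑ i ∈ s, ‖a i‖ ^ 2 * d i := by
  rw [inner_sum_smul_sum_smul_of_orthogonal s a a v w (fun i => d i) h, Complex.re_sum]
  refine Finset.sum_congr rfl fun i _ => ?_
  rw [Complex.conj_mul', ← Complex.ofReal_pow, ← Complex.ofReal_mul, Complex.ofReal_re]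

theorem linearIndependent_of_inner_eq_ite {T : H →L[ℂ] H} {n : ℕ} {Y : Fin n → H}
    (h : ∀ i j, inner ℂ (T (Y i)) (Y j) = if i = j then 1 else 0) : LinearIndependent ℂ Y := by
  rw [Fintype.linearIndependent_iff]
  intro c hc i
  have h1 : inner ℂ (T (Y i)) (∑ k, c k • Y k) = c i := by
    rw [inner_sum, Finset.sum_eq_single_of_mem i (Finset.mem_univ i)]
    · rw [inner_smul_right, h, if_pos rfl, mul_one]
    · intro k _ hk
      rw [inner_smul_right, h, if_neg hk.symm, mul_zero]
  rw [← h1, hc, inner_zero_right]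

/-- Rescaling an eigenvector to a prescribed norm moves it by the difference of the norms. -/
theorem exists_eigenvector_norm_eq {T : H →L[ℂ] H} {κ s : ℝ} (hs : 0 ≤ s) {x z : H}
    (hx : ‖x‖ = 1) (hTx : T x = (κ : ℂ) • x) (hTz : T z = (κ : ℂ) • z) :
    ∃ v, T v = (κ : ℂ) • v ∧ ‖v‖ = s ∧ ‖v - z‖ = |s - ‖z‖| := by
  rcases eq_or_ne z 0 with rfl | hz
  · refine ⟨(s : ℂ) • x, ?_, ?_, ?_⟩
    · rw [map_smul, hTx, smul_comm]
    · rw [norm_smul, hx, Complex.norm_real, Real.norm_of_nonneg hs, mul_one]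
    · rw [sub_zero, norm_zero, sub_zero, norm_smul, hx, Complex.norm_real, Real.norm_eq_abs,
        mul_one]
  · have hz' : ‖z‖ ≠ 0 := norm_ne_zero_iff.2 hz
    refine ⟨((s / ‖z‖ : ℝ) : ℂ) • z, ?_, ?_, ?_⟩
    · rw [map_smul, hTz, smul_comm]
    · rw [norm_smul, Complex.norm_real, Real.norm_of_nonneg (by positivity), div_mul_cancel₀ _ hz']
    · have : ((s / ‖z‖ : ℝ) : ℂ) • z - z = ((s / ‖z‖ - 1 : ℝ) : ℂ) • z := by
        rw [Complex.ofReal_sub, sub_smul, Complex.ofReal_one, one_smul]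
      rw [this, norm_smul, Complex.norm_real, Real.norm_eq_abs, ← abs_norm z, ← abs_mul, abs_norm]
      congr 1
      field_simp

end GramSums

/-! ### Rayleigh quotients and eigenspaces -/

namespace PosDefOp.IsLowestEigenpairs

variable {H : Type*} [NormedAddCommGroup H] [InnerProductSpace ℂ H] [CompleteSpace H]
  {A : PosDefOp H} {ℓ : ℕ} {lam : Fin ℓ → ℝ} {u : Fin ℓ → H}

/-- The part of a vector outside the `lam j`-eigenspace is controlled by the deficiency of its
Rayleigh quotient and by its components along the lower eigenvectors. -/
theorem exists_dist_eigenspace_le (h : A.IsLowestEigenpairs lam u)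
    (hess : ∀ j, ∀ z ∈ A.essSpectrum, lam j < z.re) (j : Fin ℓ) :
    ∃ g > 0, ∀ x : H, ∃ z : H, A.inv z = (((lam j)⁻¹ : ℝ) : ℂ) • z ∧
      g * ‖x - z‖ ^ 2 ≤ (lam j)⁻¹ * ‖x‖ ^ 2 - (inner ℂ (A.inv x) x).re +
        ∑ i with lam i < lam j, ((lam i)⁻¹ - (lam j)⁻¹ + g) * ‖inner ℂ (u i) x‖ ^ 2 := by
  obtain ⟨κ', hκ', hgap⟩ := h.exists_gap hess j
  set κ := (lam j)⁻¹ with hκ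
  have hT := A.inv_nonneg
  refine ⟨κ - κ', sub_pos.2 hκ', fun x => ?_⟩
  let E : Submodule ℂ H := LinearMap.ker (A.inv - (κ : ℂ) • (1 : H →L[ℂ] H)).toLinearMap
  have hE : ∀ w, w ∈ E ↔ A.inv w = (κ : ℂ) • w := by
    intro w
    simp only [E, LinearMap.mem_ker]
    exact sub_eq_zero
  have hEc : IsClosed (E : Set H) := (A.inv - (κ : ℂ) • (1 : H →L[ℂ] H)).isClosed_ker
  have : CompleteSpace E := hEc.completeSpace_coe
  set z := E.starProjection x with hz
  have hzE : A.inv z = (κ : ℂ) • z := (hE z).1 (E.starProjection_apply_mem x)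
  refine ⟨z, hzE, ?_⟩
  set I : Finset (Fin ℓ) := Finset.univ.filter fun i => lam i < lam j with hI
  set S := ∑ i ∈ I, inner ℂ (u i) x • u i with hS
  set F := x - z - S with hF
  have huE : ∀ i ∈ I, ∀ w, A.inv w = (κ : ℂ) • w → inner ℂ (u i) w = 0 := by
    intro i hi w hw
    have hi' : lam i < lam j := (Finset.mem_filter.1 hi).2
    refine ContinuousLinearMap.inner_eq_zero_of_eigenvectors hT ?_ (h.inv_apply i) hw
    exact fun he => hi'.ne (_root_.inv_injective he)
  have hFu : ∀ i ∈ I, inner ℂ (u i) F = 0 := by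
    intro i hi
    rw [hF, inner_sub_right, inner_sub_right, huE i hi z hzE, hS,
      h.orthonormal.inner_right_sum _ hi, sub_zero, sub_self]
  have hFE : ∀ w, A.inv w = (κ : ℂ) • w → inner ℂ w F = 0 := by
    intro w hw
    have h1 : inner ℂ w (x - z) = 0 := by
      rw [← inner_conj_symm, E.starProjection_inner_eq_zero x w ((hE w).2 hw), map_zero]
    rw [hF, inner_sub_right, h1, hS, inner_sum, zero_sub, neg_eq_zero]
    refine Finset.sum_eq_zero fun i hi => ?_
    rw [inner_smul_right, ← inner_conj_symm w, huE i hi w hw, map_zero, mul_zero]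
  have hg := hgap F (fun i hi => hFu i (Finset.mem_filter.2 ⟨Finset.mem_univ i, hi⟩)) hFE
  have hTS : A.inv S = ∑ i ∈ I, inner ℂ (u i) x • ((((lam i)⁻¹ : ℝ) : ℂ) • u i) := by
    rw [hS, map_sum]
    exact Finset.sum_congr rfl fun i _ => by rw [map_smul, h.inv_apply i]
  have hSF : inner ℂ S F = 0 := by
    rw [hS, sum_inner]
    exact Finset.sum_eq_zero fun i hi => by rw [inner_smul_left, hFu i hi, mul_zero]
  have hTSF : inner ℂ (A.inv S) F = 0 := by
    rw [hTS, sum_inner]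
    exact Finset.sum_eq_zero fun i hi => by
      rw [inner_smul_left, inner_smul_left, hFu i hi, mul_zero, mul_zero]
  have hon : ∀ i k, inner ℂ (u i) (u k) = if i = k then ((1 : ℝ) : ℂ) else 0 := by
    intro i k
    rw [orthonormal_iff_ite.1 h.orthonormal i k]; simp
  have hSS : ‖S‖ ^ 2 = ∑ i ∈ I, ‖inner ℂ (u i) x‖ ^ 2 := by
    have := re_inner_sum_smul_sum_smul_of_orthogonal I (fun i => inner ℂ (u i) x) u u
      (fun _ => 1) hon
    rw [← hS] at this
    rw [← inner_self_eq_norm_sq (𝕜 := ℂ) S, RCLike.re_to_complex, this]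
    simp
  have hTSS : (inner ℂ (A.inv S) S).re = ∑ i ∈ I, ‖inner ℂ (u i) x‖ ^ 2 * (lam i)⁻¹ := by
    rw [hTS]
    refine re_inner_sum_smul_sum_smul_of_orthogonal I (fun i => inner ℂ (u i) x)
      (fun i => (((lam i)⁻¹ : ℝ) : ℂ) • u i) u (fun i => (lam i)⁻¹) fun i k => ?_
    rw [inner_smul_left, hon, Complex.conj_ofReal]
    split_ifs <;> simp
  have hw : x - z = S + F := by rw [hF]; abel
  have hwz : inner ℂ (S + F) z = 0 := by
    rw [inner_add_left, ← inner_conj_symm F, hFE z hzE, map_zero, add_zero, hS, sum_inner]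
    exact Finset.sum_eq_zero fun i hi => by rw [inner_smul_left, huE i hi z hzE, mul_zero]
  have hxw : x = z + (S + F) := by rw [← hw]; abel
  have hn1 : ‖S + F‖ ^ 2 = ‖S‖ ^ 2 + ‖F‖ ^ 2 := by
    have := norm_add_sq_eq_norm_sq_add_norm_sq_of_inner_eq_zero (𝕜 := ℂ) S F hSF
    simpa [sq] using this
  have hn2 : ‖x‖ ^ 2 = ‖z‖ ^ 2 + ‖S + F‖ ^ 2 := by
    have := norm_add_sq_eq_norm_sq_add_norm_sq_of_inner_eq_zero (𝕜 := ℂ) z (S + F)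
      (by rw [← inner_conj_symm, hwz, map_zero])
    rw [← hxw] at this
    simpa [sq] using this
  have hTx : (inner ℂ (A.inv x) x).re =
      κ * ‖z‖ ^ 2 + (inner ℂ (A.inv S) S).re + (inner ℂ (A.inv F) F).re := by
    have e1 : inner ℂ (A.inv z) (S + F) = 0 := by
      rw [hzE, inner_smul_left, ← inner_conj_symm, hwz, map_zero, mul_zero]
    have e2 : inner ℂ (A.inv (S + F)) z = 0 := by
      rw [ContinuousLinearMap.inner_left_eq_right_of_nonneg hT, hzE, inner_smul_right, hwz,
        mul_zero]
    have e3 : inner ℂ (A.inv F) S = 0 := by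
      rw [ContinuousLinearMap.inner_left_eq_right_of_nonneg hT, ← inner_conj_symm, hTSF, map_zero]
    have e4 : (inner ℂ (A.inv z) z).re = κ * ‖z‖ ^ 2 := by
      rw [hzE, inner_smul_left, Complex.conj_ofReal, Complex.re_ofReal_mul]
      congr 1
      exact inner_self_eq_norm_sq (𝕜 := ℂ) z
    conv_lhs => rw [hxw]
    rw [map_add, inner_add_left, inner_add_right _ z, inner_add_right _ z, e1, e2, map_add,
      inner_add_left, inner_add_right, inner_add_right, hTSF, e3]
    simp only [Complex.add_re, e4, Complex.zero_re]
    ring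
  have hsum : ∑ i ∈ I, ((lam i)⁻¹ - κ + (κ - κ')) * ‖inner ℂ (u i) x‖ ^ 2 =
      (inner ℂ (A.inv S) S).re - κ' * ‖S‖ ^ 2 := by
    rw [hTSS, hSS, Finset.mul_sum, ← Finset.sum_sub_distrib]
    exact Finset.sum_congr rfl fun i _ => by ring
  rw [hsum, hTx, hw, hn2, hn1]
  nlinarith

/-- The variational bound behind the minimum principle. -/
theorem re_inner_inv_le (h : A.IsLowestEigenpairs lam u)
    (hess : ∀ j, ∀ z ∈ A.essSpectrum, lam j < z.re) (j : Fin ℓ) {x : H}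
    (hx : ∀ i < j, inner ℂ (u i) x = 0) :
    lam j * (inner ℂ (A.inv x) x).re ≤ ‖x‖ ^ 2 := by
  obtain ⟨g, hg, hd⟩ := h.exists_dist_eigenspace_le hess j
  obtain ⟨z, -, hz⟩ := hd x
  rw [Finset.sum_eq_zero] at hz
  · have h1 : 0 ≤ g * ‖x - z‖ ^ 2 := by positivity
    have h2 : (inner ℂ (A.inv x) x).re ≤ (lam j)⁻¹ * ‖x‖ ^ 2 := by linarith
    rwa [le_inv_mul_iff₀ (h.pos j)] at h2
  · intro i hi
    rw [hx i (h.mono.reflect_lt (Finset.mem_filter.1 hi).2)]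
    simp

end PosDefOp.IsLowestEigenpairs

/-! ### Error estimates for the Galerkin method -/

namespace PosDefOp

variable {H : Type*} [NormedAddCommGroup H] [InnerProductSpace ℂ H]

/-- The eigenpairs of the compression of the bounded operator `T` to the finite dimensional
subspace `V`, written with the reciprocals `Lam j` of its eigenvalues. The eigenvectors `Y j` span
`V` and are orthonormal with respect to the form `⟨T x, y⟩`. -/
structure IsGalerkinSystem (T : H →L[ℂ] H) (V : Submodule ℂ H) {n : ℕ} (Lam : Fin n → ℝ)
    (Y : Fin n → H) : Prop where
  mono : Monotone Lam
  galerkin : ∀ j, ∀ w ∈ V, inner ℂ w (Y j) = (Lam j : ℂ) * inner ℂ w (T (Y j))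
  orth : ∀ i j, inner ℂ (T (Y i)) (Y j) = if i = j then 1 else 0
  span : Submodule.span ℂ (Set.range Y) = V

namespace IsGalerkinSystem

variable {T : H →L[ℂ] H} {V : Submodule ℂ H} {n : ℕ} {Lam : Fin n → ℝ} {Y : Fin n → H}

theorem mem (hY : IsGalerkinSystem T V Lam Y) (j : Fin n) : Y j ∈ V :=
  hY.span ▸ Submodule.subset_span ⟨j, rfl⟩

theorem inner_eq (hT : 0 ≤ T) (hY : IsGalerkinSystem T V Lam Y) (i j : Fin n) :
    inner ℂ (Y i) (Y j) = if i = j then (Lam j : ℂ) else 0 := by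
  rw [hY.galerkin j _ (hY.mem i), ← ContinuousLinearMap.inner_left_eq_right_of_nonneg hT, hY.orth]
  split_ifs <;> simp

theorem norm_sq (hT : 0 ≤ T) (hY : IsGalerkinSystem T V Lam Y) (j : Fin n) :
    ‖Y j‖ ^ 2 = Lam j := by
  rw [← inner_self_eq_norm_sq (𝕜 := ℂ), hY.inner_eq hT, if_pos rfl]; simp

theorem pos (hT : 0 ≤ T) (hY : IsGalerkinSystem T V Lam Y) (j : Fin n) : 0 < Lam j := by
  rw [← hY.norm_sq hT]
  have : Y j ≠ 0 := fun h0 => by simpa [h0] using hY.orth j j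
  positivity

theorem exists_sum_eq (hY : IsGalerkinSystem T V Lam Y) {x : H} (hx : x ∈ V) :
    ∑ i, inner ℂ (T (Y i)) x • Y i = x := by
  rw [← hY.span, Submodule.mem_span_range_iff_exists_fun] at hx
  obtain ⟨c, rfl⟩ := hx
  refine Finset.sum_congr rfl fun i _ => ?_
  congr 1
  rw [inner_sum, Finset.sum_eq_single_of_mem i (Finset.mem_univ i)]
  · rw [inner_smul_right, hY.orth, if_pos rfl, mul_one]
  · intro k _ hk
    rw [inner_smul_right, hY.orth, if_neg hk.symm, mul_zero]

/-- The two quadratic forms in the coordinates of the system. -/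
theorem re_inner_sum (hY : IsGalerkinSystem T V Lam Y) (c : Fin n → ℂ) :
    (inner ℂ (T (∑ i, c i • Y i)) (∑ i, c i • Y i)).re = ∑ i, ‖c i‖ ^ 2 := by
  rw [map_sum]
  simp only [map_smul]
  rw [re_inner_sum_smul_sum_smul_of_orthogonal Finset.univ c (fun i => T (Y i)) Y (fun _ => 1)
    fun i j => by rw [hY.orth]; simp]
  simp

theorem norm_sq_sum (hT : 0 ≤ T) (hY : IsGalerkinSystem T V Lam Y) (c : Fin n → ℂ) :
    ‖∑ i, c i • Y i‖ ^ 2 = ∑ i, ‖c i‖ ^ 2 * Lam i := by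
  rw [← inner_self_eq_norm_sq (𝕜 := ℂ), RCLike.re_to_complex,
    re_inner_sum_smul_sum_smul_of_orthogonal Finset.univ c Y Y Lam fun i j => ?_]
  rw [hY.inner_eq hT]
  split_ifs with hij
  · rw [hij]
  · rfl

end IsGalerkinSystem

namespace IsLowestEigenpairs

variable [CompleteSpace H] {A : PosDefOp H} {ℓ : ℕ} {lam : Fin ℓ → ℝ} {u : Fin ℓ → H}
  {V : Submodule ℂ H} {n : ℕ} {Lam : Fin n → ℝ} {Y : Fin n → H}

/-- Ritz values are upper bounds: a combination of the first `j + 1` Ritz vectors is orthogonal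
to the first `j` eigenvectors. -/
theorem le_ritzValue (h : A.IsLowestEigenpairs lam u)
    (hess : ∀ j, ∀ z ∈ A.essSpectrum, lam j < z.re) (hY : IsGalerkinSystem A.inv V Lam Y)
    (j : Fin ℓ) (hj : (j : ℕ) < n) : lam j ≤ Lam ⟨j, hj⟩ := by
  have hT := A.inv_nonneg
  let s : Fin (j + 1) → Fin n := Fin.castLE hj
  have hs : Function.Injective s := Fin.castLE_injective hj
  obtain ⟨c, hc, hc0⟩ := exists_ne_zero_forall_sum_mul_eq_zero
    fun (k : Fin (j : ℕ)) (i : Fin (j + 1)) => inner ℂ (u (Fin.castLE j.2.le k)) (Y (s i))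
  set x := ∑ i, c i • Y (s i) with hx
  have hxu : ∀ i < j, inner ℂ (u i) x = 0 := by
    intro i hi
    have := hc0 ⟨i, hi⟩
    rw [hx, inner_sum]
    simp only [inner_smul_right]
    exact this
  have h1 := h.re_inner_inv_le hess j hxu
  have e1 : (inner ℂ (A.inv x) x).re = ∑ i, ‖c i‖ ^ 2 := by
    rw [hx, map_sum]
    simp only [map_smul]
    rw [re_inner_sum_smul_sum_smul_of_orthogonal Finset.univ c (fun i => A.inv (Y (s i)))
      (fun i => Y (s i)) (fun _ => 1) fun i k => by rw [hY.orth]; simp [hs.eq_iff]]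
    simp
  have e2 : ‖x‖ ^ 2 = ∑ i, ‖c i‖ ^ 2 * Lam (s i) := by
    rw [← inner_self_eq_norm_sq (𝕜 := ℂ), RCLike.re_to_complex, hx]
    refine re_inner_sum_smul_sum_smul_of_orthogonal Finset.univ c (fun i => Y (s i))
      (fun i => Y (s i)) (fun i => Lam (s i)) fun i k => ?_
    rw [hY.inner_eq hT]
    simp only [hs.eq_iff]
    split_ifs with hik
    · rw [hik]
    · rfl
  have h2 : ∑ i, ‖c i‖ ^ 2 * Lam (s i) ≤ (∑ i, ‖c i‖ ^ 2) * Lam ⟨j, hj⟩ := by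
    rw [Finset.sum_mul]
    refine Finset.sum_le_sum fun i _ => ?_
    gcongr
    refine hY.mono ?_
    rw [Fin.le_def]
    exact Nat.lt_succ_iff.1 i.2
  rw [e1, e2] at h1
  have h3 := sum_norm_sq_pos hc
  exact le_of_mul_le_mul_right (by linarith) h3

/-- The error of a Ritz value is quadratic in the distance `δ` of the eigenvectors to the trial
space: if `x` is a combination of eigenvectors, `x = P x + r`, then the mixed term
`⟨T x, r⟩ = ⟨T x - P T x, r⟩` is itself of second order. -/
theorem inv_sub_inv_ritzValue_le (h : A.IsLowestEigenpairs lam u)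
    (hY : IsGalerkinSystem A.inv V Lam Y) [V.HasOrthogonalProjection]
    (j : Fin ℓ) (hj : (j : ℕ) < n) {δ : ℝ} (hδ : ∀ i, ‖u i - V.starProjection (u i)‖ ≤ δ) :
    (lam j)⁻¹ - (Lam ⟨j, hj⟩)⁻¹ ≤ 2 * ‖A.inv‖ * ((j + 1) * δ ^ 2) := by
  have hT := A.inv_nonneg
  set T := A.inv with hTdef
  set P := V.starProjection with hP
  let s : Fin (j + 1) → Fin ℓ := Fin.castLE j.2
  have hs : Function.Injective s := Fin.castLE_injective j.2
  obtain ⟨c, hc, hc0⟩ := exists_ne_zero_forall_sum_mul_eq_zero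
    fun (k : Fin (j : ℕ)) (i : Fin (j + 1)) =>
      inner ℂ (T (Y (Fin.castLE hj.le k))) (P (u (s i)))
  set x := ∑ i, c i • u (s i) with hx
  set σ := ∑ i, ‖c i‖ ^ 2 with hσ
  have hσ0 : 0 < σ := sum_norm_sq_pos hc
  have hPx : ∀ i : Fin n, i < ⟨j, hj⟩ → inner ℂ (T (Y i)) (P x) = 0 := by
    intro i hi
    have := hc0 ⟨i, hi⟩
    rw [hx, map_sum, inner_sum]
    simp only [map_smul, inner_smul_right]
    exact this
  have hon : ∀ i k, inner ℂ (u (s i)) (u (s k)) = if i = k then ((1 : ℝ) : ℂ) else 0 := by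
    intro i k
    rw [orthonormal_iff_ite.1 h.orthonormal]; simp [hs.eq_iff]
  have hxx : ‖x‖ ^ 2 = σ := by
    rw [← inner_self_eq_norm_sq (𝕜 := ℂ), RCLike.re_to_complex, hx,
      re_inner_sum_smul_sum_smul_of_orthogonal Finset.univ c _ _ (fun _ => 1) hon]
    simp [hσ]
  have hTxs : T x = ∑ i, c i • ((((lam (s i))⁻¹ : ℝ) : ℂ) • u (s i)) := by
    rw [hx, map_sum]
    exact Finset.sum_congr rfl fun i _ => by rw [map_smul, hTdef, h.inv_apply]
  have hTxx : (lam j)⁻¹ * σ ≤ (inner ℂ (T x) x).re := by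
    rw [hTxs, hx, re_inner_sum_smul_sum_smul_of_orthogonal Finset.univ c
      (fun i => (((lam (s i))⁻¹ : ℝ) : ℂ) • u (s i)) (fun i => u (s i)) (fun i => (lam (s i))⁻¹)
      fun i k => ?_]
    · rw [hσ, Finset.mul_sum]
      refine Finset.sum_le_sum fun i _ => ?_
      rw [mul_comm]
      gcongr
      · exact h.pos _
      · refine h.mono ?_
        rw [Fin.le_def]
        exact Nat.lt_succ_iff.1 i.2
    · rw [inner_smul_left, hon, Complex.conj_ofReal]
      split_ifs <;> simp
  set r := x - P x with hr
  have hrs : r = ∑ i, c i • (u (s i) - P (u (s i))) := by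
    rw [hr, hx, map_sum, ← Finset.sum_sub_distrib]
    exact Finset.sum_congr rfl fun i _ => by rw [map_smul, smul_sub]
  set a := ((j : ℝ) + 1) * δ ^ 2 with ha
  have ha0 : 0 ≤ a := by positivity
  have hr2 : ‖r‖ ^ 2 ≤ a * σ := by
    rw [hrs]
    simpa using norm_sum_smul_sq_le c _ fun i => hδ (s i)
  have hrV : ∀ w ∈ V, inner ℂ w r = 0 := fun w hw => by
    rw [hr, ← inner_conj_symm, V.starProjection_inner_eq_zero x w hw, map_zero]
  have hT2 : ‖T x - P (T x)‖ ^ 2 ≤ ‖T‖ ^ 2 * (a * σ) := by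
    have e : T x - P (T x) =
        ∑ i, c i • ((((lam (s i))⁻¹ : ℝ) : ℂ) • (u (s i) - P (u (s i)))) := by
      rw [hTxs, map_sum, ← Finset.sum_sub_distrib]
      exact Finset.sum_congr rfl fun i _ => by rw [map_smul, map_smul, smul_sub, smul_sub]
    rw [e]
    have hb : ∀ i, ‖(((lam (s i))⁻¹ : ℝ) : ℂ) • (u (s i) - P (u (s i)))‖ ≤ ‖T‖ * δ := by
      intro i
      rw [norm_smul]
      have h1 : ‖(((lam (s i))⁻¹ : ℝ) : ℂ)‖ ≤ ‖T‖ := by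
        have h2 := T.le_opNorm (u (s i))
        rwa [hTdef, h.inv_apply, norm_smul, h.orthonormal.norm_eq_one, mul_one, mul_one] at h2
      gcongr
      exact hδ _
    refine (norm_sum_smul_sq_le c _ hb).trans (le_of_eq ?_)
    rw [ha, hσ]; simp; ring
  have hmix : ‖inner ℂ (T x) r‖ ≤ ‖T‖ * (a * σ) := by
    have e : inner ℂ (T x) r = inner ℂ (T x - P (T x)) r := by
      rw [inner_sub_left, hrV _ (V.starProjection_apply_mem _), sub_zero]
    rw [e]
    refine (norm_inner_le_norm _ _).trans ?_
    refine abs_le_of_sq_le_sq' ?_ (by positivity) |>.2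
    rw [mul_pow, mul_pow]
    calc _ ≤ ‖T‖ ^ 2 * (a * σ) * (a * σ) := by gcongr
      _ = _ := by ring
  have hxr : P x = x - r := by rw [hr]; abel
  have hq : (lam j)⁻¹ * σ - 2 * (‖T‖ * (a * σ)) ≤ (inner ℂ (T (P x)) (P x)).re := by
    have h1 : 0 ≤ (inner ℂ (T r) r).re := ((ContinuousLinearMap.nonneg_iff_isPositive T).1 hT).2 r
    have h2 : inner ℂ (T r) x = starRingEnd ℂ (inner ℂ (T x) r) := by
      rw [ContinuousLinearMap.inner_left_eq_right_of_nonneg hT, inner_conj_symm]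
    have h3 := (Complex.re_le_norm (inner ℂ (T x) r)).trans hmix
    rw [hxr, map_sub, inner_sub_left, inner_sub_right (T x) x r, inner_sub_right (T r) x r, h2]
    simp only [Complex.sub_re, Complex.conj_re]
    linarith
  have hPxV : P x ∈ V := V.starProjection_apply_mem x
  set d : Fin n → ℂ := fun i => inner ℂ (T (Y i)) (P x) with hd
  have hsum : ∑ i, d i • Y i = P x := hY.exists_sum_eq hPxV
  have hu1 : (inner ℂ (T (P x)) (P x)).re = ∑ i, ‖d i‖ ^ 2 := by
    rw [← hsum]; exact hY.re_inner_sum d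
  have hu2 : ‖P x‖ ^ 2 = ∑ i, ‖d i‖ ^ 2 * Lam i := by
    conv_lhs => rw [← hsum]
    exact hY.norm_sq_sum hT d
  have hL := hY.pos hT ⟨j, hj⟩
  have hu3 : Lam ⟨j, hj⟩ * ∑ i, ‖d i‖ ^ 2 ≤ ‖P x‖ ^ 2 := by
    rw [hu2, Finset.mul_sum]
    refine Finset.sum_le_sum fun i _ => ?_
    rcases lt_or_ge i ⟨j, hj⟩ with hi | hi
    · simp [hd, hPx i hi]
    · rw [mul_comm]
      gcongr
      exact hY.mono hi
  have hPn : ‖P x‖ ^ 2 ≤ σ := by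
    rw [← hxx]
    gcongr
    exact V.norm_starProjection_apply_le x
  have hfin : (inner ℂ (T (P x)) (P x)).re ≤ (Lam ⟨j, hj⟩)⁻¹ * σ := by
    rw [hu1, le_inv_mul_iff₀ hL]
    exact hu3.trans hPn
  refine le_of_mul_le_mul_right ?_ hσ0
  calc _ ≤ 2 * (‖T‖ * (a * σ)) := by linarith
    _ = _ := by ring

/-- A Ritz vector is nearly orthogonal to the eigenvectors of the lower eigenvalues. -/
theorem norm_inner_ritzVector_le (h : A.IsLowestEigenpairs lam u)
    (hess : ∀ j, ∀ z ∈ A.essSpectrum, lam j < z.re)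
    (hY : IsGalerkinSystem A.inv V Lam Y) [V.HasOrthogonalProjection]
    (j : Fin ℓ) (hj : (j : ℕ) < n) {δ : ℝ} (hδ : ∀ i, ‖u i - V.starProjection (u i)‖ ≤ δ)
    {i : Fin ℓ} (hi : lam i < lam j) :
    ((lam i)⁻¹ - (lam j)⁻¹) * ‖inner ℂ (u i) (Y ⟨j, hj⟩)‖ ≤ δ * (‖A.inv‖ * ‖Y ⟨j, hj⟩‖) := by
  have hT := A.inv_nonneg
  set y := Y ⟨j, hj⟩ with hy
  set L := Lam ⟨j, hj⟩ with hL
  have hL0 : 0 < L := hY.pos hT _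
  have hle : L⁻¹ ≤ (lam j)⁻¹ := inv_anti₀ (h.pos j) (h.le_ritzValue hess hY j hj)
  have hyV : y ∈ V := hY.mem _
  have h1 : inner ℂ (V.starProjection (u i)) (A.inv y) = ((L⁻¹ : ℝ) : ℂ) * inner ℂ (u i) y := by
    have e1 := hY.galerkin ⟨j, hj⟩ _ (V.starProjection_apply_mem (u i))
    rw [V.inner_starProjection_left_eq_right, Submodule.starProjection_eq_self_iff.2 hyV] at e1
    rw [e1, ← mul_assoc, ← Complex.ofReal_mul, inv_mul_cancel₀ hL0.ne', Complex.ofReal_one,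
      one_mul]
  have h2 : inner ℂ (u i) (A.inv y) = (((lam i)⁻¹ : ℝ) : ℂ) * inner ℂ (u i) y := by
    rw [← ContinuousLinearMap.inner_left_eq_right_of_nonneg hT, h.inv_apply, inner_smul_left,
      Complex.conj_ofReal]
  have h3 : ((((lam i)⁻¹ - L⁻¹ : ℝ)) : ℂ) * inner ℂ (u i) y =
      inner ℂ (u i - V.starProjection (u i)) (A.inv y) := by
    rw [inner_sub_left, h1, h2]
    push_cast
    ring
  have hpos : 0 < (lam i)⁻¹ - (lam j)⁻¹ := sub_pos.2 (inv_strictAnti₀ (h.pos i) hi)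
  calc ((lam i)⁻¹ - (lam j)⁻¹) * ‖inner ℂ (u i) y‖
      ≤ ((lam i)⁻¹ - L⁻¹) * ‖inner ℂ (u i) y‖ := by gcongr
    _ = ‖inner ℂ (u i - V.starProjection (u i)) (A.inv y)‖ := by
        rw [← h3, norm_mul, Complex.norm_real, Real.norm_of_nonneg (by linarith)]
    _ ≤ ‖u i - V.starProjection (u i)‖ * ‖A.inv y‖ := norm_inner_le_norm _ _
    _ ≤ δ * (‖A.inv‖ * ‖y‖) := by
        have := A.inv.le_opNorm y
        have h0 : 0 ≤ δ := (norm_nonneg _).trans (hδ i)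
        gcongr
        exact hδ i

/-- Ritz values and Ritz vectors approximate eigenvalues and eigenvectors with errors of order
`δ ^ 2` and `δ`, where `δ` is a bound for the distances of the eigenvectors in the list to the
trial space. Only these eigenvectors enter, even if they do not exhaust their eigenspaces. -/
theorem exists_ritz_error_le (h : A.IsLowestEigenpairs lam u)
    (hess : ∀ j, ∀ z ∈ A.essSpectrum, lam j < z.re) (j : Fin ℓ) :
    ∃ C : ℝ, ∀ {n : ℕ} {V : Submodule ℂ H} {Lam : Fin n → ℝ} {Y : Fin n → H} {δ : ℝ},
      IsGalerkinSystem A.inv V Lam Y → (∀ i, ∃ w ∈ V, ‖u i - w‖ ≤ δ) → ∀ hj : (j : ℕ) < n,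
        lam j ≤ Lam ⟨j, hj⟩ ∧ (lam j)⁻¹ - (Lam ⟨j, hj⟩)⁻¹ ≤ C * δ ^ 2 ∧
        ∃ z : H, A.inv z = (((lam j)⁻¹ : ℝ) : ℂ) • z ∧
          ‖Y ⟨j, hj⟩ - z‖ ^ 2 ≤ C * δ ^ 2 * Lam ⟨j, hj⟩ := by
  obtain ⟨g, hg, hdist⟩ := h.exists_dist_eigenspace_le hess j
  have hT := A.inv_nonneg
  set K := ‖A.inv‖
  set C1 := 2 * K * ((j : ℝ) + 1) with hC1
  set a : Fin ℓ → ℝ := fun i => (lam i)⁻¹ - (lam j)⁻¹ with ha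
  set C2 := ∑ i with lam i < lam j, (a i + g) * (K / a i) ^ 2 with hC2
  have hapos : ∀ i, lam i < lam j → 0 < a i := fun i hi =>
    sub_pos.2 (inv_strictAnti₀ (h.pos i) hi)
  have hC20 : 0 ≤ C2 := Finset.sum_nonneg fun i hi => by
    have := hapos i (Finset.mem_filter.1 hi).2
    positivity
  have hC10 : 0 ≤ C1 := by positivity
  refine ⟨max C1 (g⁻¹ * (C1 + C2)), fun {n V Lam Y δ} hY hδ hj => ?_⟩
  have hfd : FiniteDimensional ℂ V := by
    rw [← hY.span]; exact FiniteDimensional.span_of_finite ℂ (Set.finite_range Y)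
  have hδ' : ∀ i, ‖u i - V.starProjection (u i)‖ ≤ δ := by
    intro i
    obtain ⟨w, hw, hwδ⟩ := hδ i
    refine le_trans ?_ hwδ
    rw [Submodule.starProjection_minimal]
    exact ciInf_le ⟨0, by rintro _ ⟨v, rfl⟩; exact norm_nonneg _⟩ (⟨w, hw⟩ : V)
  have hval := h.inv_sub_inv_ritzValue_le hY j hj hδ'
  have hval' : (lam j)⁻¹ - (Lam ⟨j, hj⟩)⁻¹ ≤ C1 * δ ^ 2 := by
    refine hval.trans (le_of_eq ?_); rw [hC1]; ring
  refine ⟨h.le_ritzValue hess hY j hj,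
    hval'.trans (mul_le_mul_of_nonneg_right (le_max_left _ _) (sq_nonneg δ)), ?_⟩
  set y := Y ⟨j, hj⟩ with hy
  set L := Lam ⟨j, hj⟩ with hL
  have hL0 : 0 < L := hY.pos hT _
  have hyL : ‖y‖ ^ 2 = L := hY.norm_sq hT _
  obtain ⟨z, hz, hyz⟩ := hdist y
  refine ⟨z, hz, ?_⟩
  have hTy : (inner ℂ (A.inv y) y).re = 1 := by rw [hY.orth, if_pos rfl]; simp
  rw [hTy, hyL] at hyz
  have h1 : (lam j)⁻¹ * L - 1 ≤ C1 * δ ^ 2 * L := by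
    have := mul_le_mul_of_nonneg_right hval' hL0.le
    rwa [sub_mul, inv_mul_cancel₀ hL0.ne'] at this
  have h2 : ∑ i with lam i < lam j, ((lam i)⁻¹ - (lam j)⁻¹ + g) * ‖inner ℂ (u i) y‖ ^ 2 ≤
      C2 * (δ ^ 2 * L) := by
    rw [hC2, Finset.sum_mul]
    refine Finset.sum_le_sum fun i hi => ?_
    have hi' := (Finset.mem_filter.1 hi).2
    have hai := hapos i hi'
    have h3 := h.norm_inner_ritzVector_le hess hY j hj hδ' hi'
    have h4 : ‖inner ℂ (u i) y‖ ≤ K / a i * (δ * ‖y‖) := by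
      rw [div_mul_eq_mul_div, le_div_iff₀ hai, mul_comm]
      refine h3.trans (le_of_eq ?_); ring
    calc (a i + g) * ‖inner ℂ (u i) y‖ ^ 2 ≤ (a i + g) * (K / a i * (δ * ‖y‖)) ^ 2 := by
          gcongr
      _ = _ := by rw [mul_pow, mul_pow, hyL]; ring
  have h5 : ‖y - z‖ ^ 2 ≤ g⁻¹ * (C1 + C2) * δ ^ 2 * L := by
    have h6 : g * ‖y - z‖ ^ 2 ≤ (C1 + C2) * δ ^ 2 * L := by
      calc _ ≤ C1 * δ ^ 2 * L + C2 * (δ ^ 2 * L) := hyz.trans (add_le_add h1 h2)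
        _ = _ := by ring
    rw [mul_assoc, mul_assoc, le_inv_mul_iff₀ hg, ← mul_assoc]
    exact h6
  refine h5.trans ?_
  gcongr
  exact le_max_right _ _

end IsLowestEigenpairs

end PosDefOp

/-! ### The Rayleigh-Ritz method and its trial spaces -/

namespace PosDefOp

variable {H : Type*} [NormedAddCommGroup H] [InnerProductSpace ℂ H] [CompleteSpace H]
  {A : PosDefOp H}

/-- The isometry `A ^ τ` from `D(A ^ τ)` to `H` carries the Rayleigh-Ritz method in `D(A ^ τ)`
over to the Galerkin method for the bounded operator `A⁻¹` in `H`. -/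
theorem IsRitz.exists_isGalerkinSystem {τ : ℝ} (hτ : 0 ≤ τ) {n : ℕ} {x : Fin n → H}
    {Lam : Fin n → ℝ} {U : Fin n → H} (h : A.IsRitz τ x Lam U) {w : Fin n → H}
    (hw : ∀ k, (A.inv ^ τ) (w k) = x k) :
    ∃ Y : Fin n → H, (∀ j, (A.inv ^ τ) (Y j) = U j) ∧
      IsGalerkinSystem A.inv (Submodule.span ℂ (Set.range w)) Lam Y := by
  have hT := A.inv_nonneg
  obtain ⟨hmono, heig, horth⟩ := h
  choose c hc hcU using heig
  set Y : Fin n → H := fun j => ∑ k, c j k • w k with hY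
  have hYU : ∀ j, (A.inv ^ τ) (Y j) = U j := by
    intro j
    rw [hcU, hY, map_sum]
    exact Finset.sum_congr rfl fun k _ => by rw [map_smul, hw]
  have hYV : ∀ j, Y j ∈ Submodule.span ℂ (Set.range w) := fun j =>
    Submodule.sum_mem _ fun k _ => Submodule.smul_mem _ _ (Submodule.subset_span ⟨k, rfl⟩)
  have hinner : ∀ i k, A.fracInner τ (x i) (x k) = inner ℂ (w i) (w k) := by
    intro i k
    rw [fracInner, ← hw, ← hw, A.powApply_rpow hτ, A.powApply_rpow hτ]
  have hinner' : ∀ i k, A.fracInner τ (A.inv (x i)) (x k) = inner ℂ (A.inv (w i)) (w k) := by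
    intro i k
    have hcomm : A.inv ((A.inv ^ τ) (w i)) = (A.inv ^ τ) (A.inv (w i)) := by
      have h1 := ContinuousLinearMap.rpow_add_apply hT hτ zero_le_one (w i)
      have h2 := ContinuousLinearMap.rpow_add_apply hT zero_le_one hτ (w i)
      rw [CFC.rpow_one _ hT] at h1 h2
      rw [← h1, ← h2, add_comm]
    rw [fracInner, ← hw, ← hw, hcomm, A.powApply_rpow hτ, A.powApply_rpow hτ]
  have horthY : ∀ i j, inner ℂ (A.inv (Y i)) (Y j) = if i = j then 1 else 0 := by
    intro i j
    rw [← horth i j, ← A.inner_rpow_half, fracInner, ← hYU, ← hYU,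
      (A.powApply_sub hτ (by norm_num) _).2, (A.powApply_sub hτ (by norm_num) _).2]
  refine ⟨Y, hYU, hmono, fun j v hv => ?_, horthY, ?_⟩
  · induction hv using Submodule.span_induction with
    | mem v hv =>
      obtain ⟨i, rfl⟩ := hv
      have h1 := congrFun (hc j) i
      simp only [Matrix.mulVec, dotProduct, Matrix.of_apply, Pi.smul_apply, smul_eq_mul,
        hinner, hinner'] at h1
      rw [← ContinuousLinearMap.inner_left_eq_right_of_nonneg hT, hY]
      simp only [inner_sum, inner_smul_right]
      calc _ = ∑ k, inner ℂ (w i) (w k) * c j k := Finset.sum_congr rfl fun k _ => mul_comm _ _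
        _ = _ := h1
        _ = _ := by
          congr 1
          exact Finset.sum_congr rfl fun k _ => mul_comm _ _
    | zero => simp
    | add a b _ _ ha hb => rw [inner_add_left, inner_add_left, ha, hb, mul_add]
    | smul a v _ hv => rw [inner_smul_left, inner_smul_left, hv, mul_left_comm]
  · have : FiniteDimensional ℂ (Submodule.span ℂ (Set.range w)) :=
      FiniteDimensional.span_of_finite ℂ (Set.finite_range w)
    refine Submodule.eq_of_le_of_finrank_le (Submodule.span_le.2 ?_) ?_
    · rintro _ ⟨j, rfl⟩
      exact hYV j
    · rw [finrank_span_eq_card (linearIndependent_of_inner_eq_ite horthY)]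
      exact finrank_range_le_card w

section TrialSpaces

variable {G : Type*} [NormedAddCommGroup G] [InnerProductSpace ℂ G] [CompleteSpace G]
  (e : G ≃L[ℂ] H) {M : PosDefOp G}

/-- The approximation property of the trial spaces: transported by `A ^ τ`, they approximate an
eigenvector in the domain of `M ^ σ` with an error of smaller order than `μ n ^ (τ - σ)`. -/
theorem exists_isLittleO_dist_trialSpace (hMcomp : IsCompactOperator M.inv)
    {μ : ℕ → ℝ} {q : ℕ → G} (hMq : M.IsLowestEigenpairs μ q) (hμ : Tendsto μ atTop atTop)
    (hMA : ∃ C : ℝ, ∀ x : M.op.domain,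
      ∃ h : e (x : G) ∈ A.op.domain, ‖A.op ⟨e (x : G), h⟩‖ ≤ C * ‖M.op x‖)
    {τ σ : ℝ} (hτ0 : 0 ≤ τ) (hτ1 : τ ≤ 1) (hσ : τ ≤ σ) {w : ℕ → H}
    (hw : ∀ k, (A.inv ^ τ) (w k) = e (q k)) {a : ℝ} {x : H} (hx0 : x ≠ 0)
    (hx : A.IsEigen (a : ℂ) x) (hxM : e.symm x ∈ (M.rpow σ).domain) :
    ∃ v : ℕ → H, (∀ n, x - v n ∈ Submodule.span ℂ (Set.range fun k : Fin n => w k)) ∧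
      (fun n => ‖v n‖) =o[atTop] fun n => μ n ^ (τ - σ) := by
  have hT := A.inv_nonneg
  have hN := M.inv_nonneg
  have ha : 0 < a := A.pos_of_isEigen hx0 hx
  obtain ⟨C, hC⟩ := hMA
  obtain ⟨D, hD⟩ := ContinuousLinearMap.exists_norm_le_of_rpow_apply_eq hT A.inv_injective hN
    (e : G →L[ℂ] H) (C := C) (fun c => by
      obtain ⟨hd, hb⟩ := hC ⟨M.inv c, M.inv_mem c⟩
      refine ⟨A.op ⟨e (M.inv c), hd⟩, A.inv_op _, ?_⟩
      rwa [M.op_inv] at hb) hτ0 hτ1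
  obtain ⟨y, hy⟩ := (M.mem_rpow_domain (hτ0.trans hσ)).1 hxM
  set z := (M.inv ^ (σ - τ)) y with hz
  have hzx : (M.inv ^ τ) z = e.symm x := by
    rw [hz, ← ContinuousLinearMap.rpow_add_apply hN hτ0 (sub_nonneg.2 hσ), add_sub_cancel, hy]
  have hlittle := M.isLittleO_sub_sum_inner hMcomp hMq hμ (sub_nonneg.2 hσ) y
  rw [← hz, neg_sub] at hlittle
  set κ : ℂ := ((a⁻¹ ^ τ : ℝ) : ℂ) with hκ
  have hκ0 : κ ≠ 0 := by
    rw [hκ]; exact_mod_cast (Real.rpow_pos_of_pos (inv_pos.2 ha) τ).ne'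
  have hκx : (A.inv ^ τ) x = κ • x :=
    ContinuousLinearMap.rpow_apply_of_eigenvector hT hτ0 (A.inv_apply_of_isEigen hx0 hx)
  let r : ℕ → H := fun n =>
    κ⁻¹ • x - ∑ k ∈ Finset.range n, (inner ℂ (q k) z * ((μ k ^ (-τ) : ℝ) : ℂ)) • w k
  have hr : ∀ n, ‖r n‖ ≤ D * ‖z - ∑ k ∈ Finset.range n, inner ℂ (q k) z • q k‖ := by
    intro n
    refine hD _ _ ?_
    simp only [r]
    rw [map_sub, map_sub, map_smul, hκx, inv_smul_smul₀ hκ0, hzx, map_sub, map_sum, map_sum,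
      map_sum]
    congr 1
    · exact (e.apply_symm_apply x).symm
    · refine Finset.sum_congr rfl fun k _ => ?_
      rw [map_smul, map_smul, hMq.inv_rpow_apply hτ0, smul_smul, hw, map_smul]
      rfl
  refine ⟨fun n => κ • r n, fun n => ?_, ?_⟩
  · have : x - κ • r n =
        ∑ k ∈ Finset.range n, κ • (inner ℂ (q k) z * ((μ k ^ (-τ) : ℝ) : ℂ)) • w k := by
      simp only [r]
      rw [smul_sub, smul_inv_smul₀ hκ0, sub_sub_cancel, Finset.smul_sum]
    rw [this]
    refine Submodule.sum_mem _ fun k hk => Submodule.smul_mem _ _ (Submodule.smul_mem _ _ ?_)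
    exact Submodule.subset_span ⟨⟨k, Finset.mem_range.1 hk⟩, rfl⟩
  · refine IsBigO.trans_isLittleO (IsBigO.of_bound (‖κ‖ * |D|) ?_) hlittle
    refine Eventually.of_forall fun n => ?_
    rw [norm_norm, norm_norm, norm_smul, mul_assoc]
    gcongr
    refine (hr n).trans ?_
    gcongr
    exact le_abs_self D

end TrialSpaces

end PosDefOp

/-! ### Convergence of Ritz values and Ritz vectors -/

/-- The scalar form of the error estimate, passing from reciprocals to the eigenvalues. -/
theorem sub_le_of_inv_sub_inv_le {l L ε : ℝ} (hl : 0 < l) (hlL : l ≤ L)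
    (h : l⁻¹ - L⁻¹ ≤ ε) (hε : ε ≤ l⁻¹ / 2) : L ≤ 2 * l ∧ L - l ≤ 2 * l ^ 2 * ε := by
  have hL : 0 < L := hl.trans_le hlL
  have h1 : L ≤ 2 * l := by
    have : (2 * l)⁻¹ ≤ L⁻¹ := by rw [mul_inv]; linarith
    exact (inv_le_inv₀ (by positivity) hL).1 this
  refine ⟨h1, ?_⟩
  have h0 : 0 ≤ l⁻¹ - L⁻¹ := sub_nonneg.2 (inv_anti₀ hl hlL)
  calc L - l = l * L * (l⁻¹ - L⁻¹) := by field_simp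
    _ ≤ l * (2 * l) * ε := by gcongr
    _ = _ := by ring

theorem proposition4p2
    -- the space `H₀` and the operator `A`
    {H : Type*} [NormedAddCommGroup H] [InnerProductSpace ℂ H] [CompleteSpace H]
    [TopologicalSpace.SeparableSpace H] (A : PosDefOp H)
    -- the space `G₀`: the same elements, identified by `e`, with an equivalent norm
    {G : Type*} [NormedAddCommGroup G] [InnerProductSpace ℂ G] [CompleteSpace G]
    (e : G ≃L[ℂ] H)
    -- the operator `M` with compact inverse, all its eigenvalues and an orthonormal family of
    -- corresponding eigenvectors; here `μ n` and `q n` are `μ_{n+1}` and `q_{n+1}`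
    (M : PosDefOp G) (hMcomp : IsCompactOperator M.inv)
    (μ : ℕ → ℝ) (q : ℕ → G) (hMq : M.IsLowestEigenpairs μ q) (hμ : Tendsto μ atTop atTop)
    -- the first `ℓ` eigenpairs of `A`, below its essential spectrum
    (ℓ : ℕ) (lam : Fin ℓ → ℝ) (u : Fin ℓ → H) (hAu : A.IsLowestEigenpairs lam u)
    (hess : ∀ j, ∀ z ∈ A.essSpectrum, lam j < z.re)
    -- `D(M)` is continuously contained in `D(A)`
    (hMA : ∃ C : ℝ, ∀ x : M.op.domain,
      ∃ h : e (x : G) ∈ A.op.domain, ‖A.op ⟨e (x : G), h⟩‖ ≤ C * ‖M.op x‖)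
    (τ σ : ℝ) (hτ0 : 0 ≤ τ) (hτ1 : τ ≤ 1) (hσ : τ ≤ σ)
    (hu : ∀ j, e.symm (u j) ∈ (M.rpow σ).domain)
    -- the Rayleigh-Ritz eigenvalues and eigenvectors in `D(A ^ τ)`, for each `n`, with the trial
    -- vectors `q_1, …, q_n` (only the values at indices `j < n` are used)
    (Lam : ℕ → ℕ → ℝ) (U : ℕ → ℕ → H)
    (hRitz : ∀ n, A.IsRitz τ (fun k : Fin n => e (q k)) (fun j : Fin n => Lam n j)
      (fun j : Fin n => U n j)) :
    ∀ j : Fin ℓ,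
      ((fun n => Lam n j - lam j) =o[atTop] fun n => μ n ^ (2 * τ - 2 * σ)) ∧
      ∃ v : ℕ → H,
        (∀ n, A.IsEigen (lam j : ℂ) (v n) ∧ v n ∈ (A.rpow (τ - 1 / 2)).domain ∧
          A.fracNorm (τ - 1 / 2) (v n) = 1) ∧
        (∀ n, (j : ℕ) < n → v n - U n j ∈ (A.rpow τ).domain) ∧
        (fun n => A.fracNorm τ (v n - U n j)) =o[atTop] fun n => μ n ^ (τ - σ) := by
  have hT := A.inv_nonneg
  have hdomain : ∀ k, ∃ w, (A.inv ^ τ) w = e (q k) := by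
    intro k
    obtain ⟨C, hC⟩ := hMA
    obtain ⟨hd, -⟩ := hMq.eigen k
    obtain ⟨hd', -⟩ := hC ⟨q k, hd⟩
    obtain ⟨y, hy⟩ := A.mem_domain_iff.1 hd'
    refine ⟨(A.inv ^ (1 - τ)) y, ?_⟩
    rw [← ContinuousLinearMap.rpow_add_apply hT hτ0 (sub_nonneg.2 hτ1), add_sub_cancel,
      CFC.rpow_one _ hT, hy]
  choose w hw using hdomain
  choose r hrV hr using fun j => A.exists_isLittleO_dist_trialSpace e hMcomp hMq hμ hMA hτ0 hτ1 hσ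
    hw (hAu.ne_zero j) (hAu.eigen j) (hu j)
  choose Y hYU hY using fun n => (hRitz n).exists_isGalerkinSystem hτ0
    (w := fun k : Fin n => w k) fun k => hw k
  -- a common bound for the distances of all eigenvectors in the list to the trial spaces
  set δ : ℕ → ℝ := fun n => ∑ i, ‖r i n‖ with hδ
  have hδ0 : ∀ n, 0 ≤ δ n := fun n => Finset.sum_nonneg fun i _ => norm_nonneg _
  have hδo : δ =o[atTop] fun n => μ n ^ (τ - σ) := by
    refine (IsLittleO.sum (s := Finset.univ) fun i _ => hr i).congr_left fun n => ?_
    simp [hδ]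
  have hδ2 : (fun n => δ n ^ 2) =o[atTop] fun n => μ n ^ (2 * τ - 2 * σ) := by
    refine (hδo.pow two_pos).congr_right fun n => ?_
    rw [← Real.rpow_mul_natCast (hMq.pos n).le]
    congr 1
    push_cast
    ring
  have hδlim : Tendsto δ atTop (nhds 0) := by
    have h1 : (fun n => μ n ^ (τ - σ)) =O[atTop] fun _ => (1 : ℝ) := by
      refine IsBigO.of_bound 1 ?_
      filter_upwards [hμ.eventually_ge_atTop 1] with n hn
      rw [Real.norm_of_nonneg (Real.rpow_nonneg (hMq.pos n).le _), norm_one, mul_one]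
      exact Real.rpow_le_one_of_one_le_of_nonpos hn (sub_nonpos.2 hσ)
    exact (isLittleO_one_iff ℝ).1 (hδo.trans_isBigO h1)
  have hdist : ∀ n i, ∃ v ∈ Submodule.span ℂ (Set.range fun k : Fin n => w k),
      ‖u i - v‖ ≤ δ n := by
    intro n i
    refine ⟨_, hrV i n, ?_⟩
    rw [sub_sub_cancel]
    exact Finset.single_le_sum (f := fun i => ‖r i n‖) (fun i _ => norm_nonneg _)
      (Finset.mem_univ i)
  intro j
  have hl : 0 < lam j := hAu.pos j
  obtain ⟨C, hC⟩ := hAu.exists_ritz_error_le hess j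
  have hC' := fun n (hj : (j : ℕ) < n) => hC (hY n) (hdist n) hj
  -- for large `n` the estimates hold with constants independent of `n`
  have hlarge : ∀ᶠ n in atTop, (j : ℕ) < n ∧ δ n ≤ 1 ∧ Lam n j ≤ 2 * lam j ∧ lam j ≤ Lam n j ∧
      Lam n j - lam j ≤ 2 * lam j ^ 2 * (C * δ n ^ 2) := by
    have h1 : Tendsto (fun n => C * δ n ^ 2) atTop (nhds 0) := by
      have := (hδlim.pow 2).const_mul C
      simpa using this
    filter_upwards [eventually_gt_atTop (j : ℕ), hδlim.eventually_le_const one_pos,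
      h1.eventually_le_const (show 0 < (lam j)⁻¹ / 2 by positivity)] with n hn hn1 hn2
    obtain ⟨h2, h3, -⟩ := hC' n hn
    obtain ⟨h4, h5⟩ := sub_le_of_inv_sub_inv_le hl h2 h3 hn2
    exact ⟨hn, hn1, h4, h2, h5⟩
  refine ⟨?_, ?_⟩
  · refine IsBigO.trans_isLittleO (IsBigO.of_bound (2 * lam j ^ 2 * C) ?_) hδ2
    filter_upwards [hlarge] with n ⟨_, _, _, h1, h2⟩
    rw [Real.norm_of_nonneg (sub_nonneg.2 h1), Real.norm_of_nonneg (sq_nonneg _), mul_assoc]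
    exact h2
  set κ := (lam j)⁻¹ with hκ
  have hz : ∀ n, ∃ z : H, A.inv z = (κ : ℂ) • z ∧ ‖z‖ = √(lam j) ∧
      ∀ hn : (j : ℕ) < n, ‖z - Y n ⟨j, hn⟩‖ ≤
        |√(lam j) - √(Lam n j)| + 2 * √(C * δ n ^ 2 * Lam n j) := by
    intro n
    have hu1 := hAu.orthonormal.norm_eq_one j
    have hTu := hAu.inv_apply j
    by_cases hn : (j : ℕ) < n
    · obtain ⟨-, -, Z, hZ, hZle⟩ := hC' n hn
      obtain ⟨z, hz1, hz2, hz3⟩ :=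
        exists_eigenvector_norm_eq (T := A.inv) (Real.sqrt_nonneg (lam j)) hu1 hTu hZ
      refine ⟨z, hz1, hz2, fun _ => ?_⟩
      have h1 : ‖Y n ⟨j, hn⟩‖ = √(Lam n j) := by
        rw [← (hY n).norm_sq hT ⟨j, hn⟩, Real.sqrt_sq (norm_nonneg _)]
      have h2 : ‖Y n ⟨j, hn⟩ - Z‖ ≤ √(C * δ n ^ 2 * Lam n j) := Real.le_sqrt_of_sq_le hZle
      have h3 : |‖Y n ⟨j, hn⟩‖ - ‖Z‖| ≤ ‖Y n ⟨j, hn⟩ - Z‖ := abs_norm_sub_norm_le _ _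
      have h4 : ‖z - Y n ⟨j, hn⟩‖ ≤ ‖z - Z‖ + ‖Y n ⟨j, hn⟩ - Z‖ := by
        rw [norm_sub_rev (Y n ⟨j, hn⟩) Z]
        exact norm_sub_le_norm_sub_add_norm_sub _ _ _
      have h5 := abs_sub_le (√(lam j)) ‖Y n ⟨j, hn⟩‖ ‖Z‖
      rw [hz3] at h4
      rw [h1] at h3 h5
      linarith
    · obtain ⟨z, hz1, hz2, -⟩ :=
        exists_eigenvector_norm_eq (T := A.inv) (Real.sqrt_nonneg (lam j)) hu1 hTu hTu
      exact ⟨z, hz1, hz2, fun h => absurd h hn⟩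
  choose z hz1 hz2 hz3 using hz
  have hκτ : ∀ n, (A.inv ^ τ) (z n) = ((κ ^ τ : ℝ) : ℂ) • z n := fun n =>
    ContinuousLinearMap.rpow_apply_of_eigenvector hT hτ0 (hz1 n)
  refine ⟨fun n => (A.inv ^ τ) (z n), fun n => ⟨?_, ?_, ?_⟩, fun n hn => ?_, ?_⟩
  · rw [A.isEigen_iff (by exact_mod_cast hl.ne')]
    simp only [hκτ]
    rw [map_smul, hz1, smul_comm, hκ, Complex.ofReal_inv]
  · exact (A.powApply_sub hτ0 (by norm_num) _).1
  · have h1 : ‖(A.inv ^ (1 / 2 : ℝ)) (z n)‖ ^ 2 = 1 := by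
      rw [← inner_self_eq_norm_sq (𝕜 := ℂ), A.inner_rpow_half, hz1, inner_smul_left,
        Complex.conj_ofReal, RCLike.re_to_complex, Complex.re_ofReal_mul, ← RCLike.re_to_complex,
        inner_self_eq_norm_sq, hz2, Real.sq_sqrt hl.le, hκ, inv_mul_cancel₀ hl.ne']
    rw [PosDefOp.fracNorm, (A.powApply_sub hτ0 (by norm_num) _).2]
    exact (pow_eq_one_iff_of_nonneg (norm_nonneg _) two_ne_zero).1 h1
  · rw [← hYU n ⟨j, hn⟩, ← map_sub]
    exact A.rpow_apply_mem hτ0 _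
  · refine IsBigO.trans_isLittleO (g := δ) (IsBigO.of_bound
      (2 * lam j ^ 2 * |C| / √(lam j) + 2 * √(|C| * (2 * lam j))) ?_) hδo
    filter_upwards [hlarge] with n ⟨hn, h1, h2, h3, h4⟩
    have e1 : A.fracNorm τ ((A.inv ^ τ) (z n) - U n j) = ‖z n - Y n ⟨j, hn⟩‖ := by
      rw [← hYU n ⟨j, hn⟩, ← map_sub, PosDefOp.fracNorm, A.powApply_rpow hτ0]
    rw [e1, norm_norm, Real.norm_of_nonneg (hδ0 n), add_mul]
    refine (hz3 n hn).trans (add_le_add ?_ ?_)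
    · have hs : 0 < √(lam j) := Real.sqrt_pos.2 hl
      have hle : √(lam j) ≤ √(Lam n j) := Real.sqrt_le_sqrt h3
      rw [abs_sub_comm, abs_of_nonneg (sub_nonneg.2 hle), div_mul_eq_mul_div, le_div_iff₀ hs]
      have h5 : (√(Lam n j) - √(lam j)) * (√(Lam n j) + √(lam j)) = Lam n j - lam j := by
        have e2 := Real.mul_self_sqrt hl.le
        have e3 := Real.mul_self_sqrt (hl.le.trans h3)
        linear_combination e3 - e2
      have hδsq : δ n ^ 2 ≤ δ n := by nlinarith [hδ0 n]
      calc (√(Lam n j) - √(lam j)) * √(lam j)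
          ≤ (√(Lam n j) - √(lam j)) * (√(Lam n j) + √(lam j)) := by
            have := Real.sqrt_nonneg (Lam n j)
            exact mul_le_mul_of_nonneg_left (by linarith) (sub_nonneg.2 hle)
        _ ≤ 2 * lam j ^ 2 * (C * δ n ^ 2) := h5.trans_le h4
        _ ≤ 2 * lam j ^ 2 * (|C| * δ n) := by
            have : C * δ n ^ 2 ≤ |C| * δ n :=
              mul_le_mul (le_abs_self C) hδsq (sq_nonneg _) (abs_nonneg C)
            gcongr
        _ = _ := by ring
    · have h6 : √(C * δ n ^ 2 * Lam n j) ≤ √(|C| * (2 * lam j) * δ n ^ 2) := by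
        refine Real.sqrt_le_sqrt ?_
        have : C * δ n ^ 2 * Lam n j ≤ |C| * δ n ^ 2 * (2 * lam j) := by
          have h0 : 0 ≤ Lam n j := hl.le.trans h3
          gcongr
          exact le_abs_self C
        linarith
      rw [Real.sqrt_mul (x := |C| * (2 * lam j)) (by positivity), Real.sqrt_sq (hδ0 n)] at h6
      linarith
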